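/- Let $n\ge 3$, let $Cl_n$ be the real Clifford algebra generated by $e_1,\dots,e_n$ with $e_ie_j+e_je_i=-2\delta_{ij}$, and identify $x\in\mathbb R^n$ with $x_1e_1+\dots+x_ne_n\in Cl_n$, so that $x^{-1}=-x/\|x\|^2$ for $x\neq 0$. Let $Cl_{n-1}$ be the subalgebra generated by $e_1,\dots,e_{n-1}$. Write $A\in Cl_n$ uniquely as $A=P(A)+Q(A)e_n$ with $P(A),Q(A)\in Cl_{n-1}$, and put $\hat A=P(A)-Q(A)e_n$ and $Q'(A)=-e_nQ(A)e_n$; in particular $\hat y=y_1e_1+\dots+y_{n-1}e_{n-1}-y_ne_n$ for vectors $y$. Let $\mathbb R^{n,+}=\{x\in\mathbb R^n: x_n>0\}$. The Dirac-Hodge operator is $$Mf(y)=\sum_{j=1}^n e_j\frac{\partial f}{\partial y_j}(y)+\frac{n-2}{y_n}Q'(f(y)).$$ For $x\ne y$ in $\mathbb R^{n,+}$ put $$E(x,y)=\frac{(x-y)^{-1}}{\|x-y\|^{n-2}\|x-\hat y\|^{n-2}},\qquad F(x,y)=\frac{(\hat x-y)^{-1}}{\|x-y\|^{n-2}\|\hat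 x-y\|^{n-2}},$$ and let $\omega_n$ be the surface area of the unit sphere of $\mathbb R^n$. Theorem. Let $K$ be a bounded open set with $\overline K\subset\mathbb R^{n,+}$ (for instance a bounded region with smooth boundary in $\mathbb R^{n,+}$), and let $L\in C^1(\overline K)$ take values in $Cl_n$, that is, $L$ is continuous on $\overline K$, differentiable on $K$, and its derivative on $K$ extends continuously to $\overline K$. Define $$I(y)=-\frac{2^{n-2}y_n^{n-2}}{\omega_n}\left(\int_K E(x,y)L(x)\,dx-\int_K F(x,y)\hat L(x)\,dx\right).$$ Then for every $y\in K$ both integrals converge absolutely, $I$ is differentiable at $y$, and $$M(I)(y)=L(y).$$ So $I$ is a right inverse (a Teodorescu-type transform) of the Dirac-Hodge operator on $K$. -/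

import Mathlib

open MeasureTheory

namespace DiracHodge

noncomputable section

/-- Euclidean space `R^n` with `n = k + 2`. -/
abbrev Space (k : ℕ) : Type := EuclideanSpace ℝ (Fin (k + 2))

/-- The index of the last coordinate `x_n`. -/
abbrev lastIdx (k : ℕ) : Fin (k + 2) := Fin.last (k + 1)

/-- Upper half space `R^{n,+} = {x : x_n > 0}`. -/
def upperHalfSpace (k : ℕ) : Set (Space k) := {x | 0 < x (lastIdx k)}

/-- The reflection `ŷ` of `y` in the hyperplane `x_n = 0`, as a linear map. -/
def reflLast (k : ℕ) : Space k →ₗ[ℝ] Space k where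
  toFun y := WithLp.toLp 2 (fun i => if i = lastIdx k then -(y i) else y i)
  map_add' x y := by
    ext i
    by_cases h : i = lastIdx k
    · simp [h, add_comm]
    · simp [h]
  map_smul' c x := by
    ext i
    by_cases h : i = lastIdx k <;> simp [h]

/-- The negative definite quadratic form `x ↦ -‖x‖²`. -/
def negForm (k : ℕ) : QuadraticForm ℝ (Space k) :=
  -(LinearMap.BilinMap.toQuadraticMap (innerₗ (Space k)))

theorem negForm_apply (k : ℕ) (x : Space k) : negForm k x = -‖x‖ ^ 2 := by
  simp [negForm]

/-- The real Clifford algebra `Cl_n`, in which `v ^ 2 = -‖v‖²` for vectors `v`. -/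
abbrev Cl (k : ℕ) : Type := CliffordAlgebra (negForm k)

/-- The embedding of vectors into the Clifford algebra. -/
abbrev vec {k : ℕ} (x : Space k) : Cl k := CliffordAlgebra.ι (negForm k) x

/-- The generators `e_1, …, e_n`. -/
def e {k : ℕ} (j : Fin (k + 2)) : Cl k := vec (EuclideanSpace.single j 1)

/-- The last generator `e_n`. -/
abbrev eLast (k : ℕ) : Cl k := e (lastIdx k)

theorem vec_mul_self {k : ℕ} (x : Space k) : vec x * vec x = (-‖x‖ ^ 2) • (1 : Cl k) := by
  rw [vec, CliffordAlgebra.ι_sq_scalar, negForm_apply, Algebra.algebraMap_eq_smul_one]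

theorem e_mul_self {k : ℕ} (j : Fin (k + 2)) : e j * e j = (-1 : Cl k) := by
  rw [e, vec_mul_self]
  simp

theorem e_mul_comm {k : ℕ} {i j : Fin (k + 2)} (h : i ≠ j) : e i * e j = -(e j * e i : Cl k) := by
  have h1 := vec_mul_self (EuclideanSpace.single i (1 : ℝ) + EuclideanSpace.single j 1 : Space k)
  have hn : ‖(EuclideanSpace.single i (1 : ℝ) + EuclideanSpace.single j 1 : Space k)‖ ^ 2 = 2 := by
    rw [norm_add_sq_real, EuclideanSpace.inner_single_left, PiLp.single_apply, if_neg h]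
    simp only [PiLp.norm_single]
    norm_num
  rw [hn, vec, map_add] at h1
  have hi := e_mul_self (k := k) i
  have hj := e_mul_self (k := k) j
  simp only [e, vec] at hi hj ⊢
  rw [add_mul, mul_add, mul_add, hi, hj] at h1
  have h2 : ((-2 : ℝ) • (1 : Cl k)) = -1 + -1 := by
    rw [show (-2 : ℝ) = -1 + -1 by norm_num, add_smul, neg_one_smul]
  rw [h2] at h1
  rw [eq_neg_iff_add_eq_zero]
  have h3 := sub_eq_zero.mpr h1
  rw [← h3]
  abel

/-- The inverse `v⁻¹ = -v / ‖v‖²` of a vector in the Clifford algebra (and `0` for `v = 0`). -/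
def vecInv {k : ℕ} (v : Space k) : Cl k := (-(‖v‖ ^ 2)⁻¹) • vec v

theorem vec_mul_vecInv {k : ℕ} {v : Space k} (hv : v ≠ 0) :
    vec v * vecInv v = 1 ∧ vecInv v * vec v = 1 := by
  have h : ‖v‖ ^ 2 ≠ 0 := by simpa using hv
  constructor <;>
    simp only [vecInv, mul_smul_comm, smul_mul_assoc, vec_mul_self, smul_smul] <;>
    field_simp <;> simp

/-- The basis `(e_A)` of `Cl_n`, indexed by the subsets `A` of `{1, …, n}`. -/
def cliffordBasis (k : ℕ) : Module.Basis (Finset (Fin (k + 2))) ℝ (Cl k) :=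
  ((EuclideanSpace.basisFun (Fin (k + 2)) ℝ).toBasis.ExteriorAlgebra).map
    (CliffordAlgebra.equivExterior (negForm k)).symm

theorem contractLeft_prod_eq_zero {k : ℕ} (q : QuadraticForm ℝ (Space k))
    (d : Module.Dual ℝ (Space k)) (l : List (Fin (k + 2)))
    (hl : ∀ j ∈ l, d (EuclideanSpace.single j 1) = 0) :
    CliffordAlgebra.contractLeft d
      (l.map (fun j => CliffordAlgebra.ι q (EuclideanSpace.single j 1))).prod = 0 := by
  induction l with
  | nil => simp
  | cons a l ih =>
    rw [List.map_cons, List.prod_cons, CliffordAlgebra.contractLeft_ι_mul,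
      ih (fun j hj => hl j (List.mem_cons_of_mem _ hj)), hl a List.mem_cons_self]
    simp

theorem equivExterior_prod {k : ℕ} (l : List (Fin (k + 2))) (hl : l.Nodup) :
    CliffordAlgebra.equivExterior (negForm k) (l.map e).prod =
      (l.map (fun j => ExteriorAlgebra.ι ℝ (EuclideanSpace.single j 1 : Space k))).prod := by
  induction l with
  | nil =>
    simp only [List.map_nil, List.prod_nil]
    exact CliffordAlgebra.changeForm_one CliffordAlgebra.changeForm.associated_neg_proof
  | cons a l ih =>
    have ih' := ih (List.nodup_cons.mp hl).2
    rw [List.map_cons, List.prod_cons, List.map_cons, List.prod_cons, ← ih']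
    refine (CliffordAlgebra.changeForm_ι_mul
      CliffordAlgebra.changeForm.associated_neg_proof _ _).trans ?_
    change _ - CliffordAlgebra.contractLeft _
      (CliffordAlgebra.equivExterior (negForm k) (l.map e).prod) = _
    rw [ih', sub_eq_self.mpr]
    · rw [← ih']
      rfl
    · refine contractLeft_prod_eq_zero (k := k) 0 _ l fun j hj => ?_
      have hne : a ≠ j := fun h => (List.nodup_cons.mp hl).1 (h ▸ hj)
      simp [negForm, QuadraticMap.associated_apply, EuclideanSpace.inner_single_left, hne]

/-- `e_A` is the product of the `e_j`, `j ∈ A`, in increasing order of the indices. -/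
theorem cliffordBasis_apply (k : ℕ) (A : Finset (Fin (k + 2))) :
    cliffordBasis k A = (A.sort.map e).prod := by
  rw [cliffordBasis, Module.Basis.map_apply, LinearEquiv.symm_apply_eq,
    equivExterior_prod _ (A.sort_nodup _), ExteriorAlgebra.basis_apply_ofCard _ rfl,
    ExteriorAlgebra.ιMulti_family, ExteriorAlgebra.ιMulti_apply]
  congr 1
  apply List.ext_getElem
  · simp
  · intro i h1 h2
    simp [Set.powersetCard.ofFinEmbEquiv_symm_apply, Finset.orderEmbOfFin_apply]

instance (k : ℕ) : FiniteDimensional ℝ (Cl k) := (cliffordBasis k).finiteDimensional_of_finite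

/-- The coefficients of an element of `Cl_n` in the basis `(e_A)`. -/
def coeffs (k : ℕ) : Cl k →ₗ[ℝ] EuclideanSpace ℝ (Finset (Fin (k + 2))) :=
  (WithLp.linearEquiv 2 ℝ (Finset (Fin (k + 2)) → ℝ)).symm.toLinearMap ∘ₗ
    (cliffordBasis k).equivFun.toLinearMap

theorem coeffs_injective (k : ℕ) : Function.Injective (coeffs k) :=
  (WithLp.linearEquiv 2 ℝ (Finset (Fin (k + 2)) → ℝ)).symm.injective.comp
    (cliffordBasis k).equivFun.injective

/-- The norm `‖A‖ = (Σ_A a_A²)^{1/2}` on `Cl_n`. -/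
instance (k : ℕ) : NormedAddCommGroup (Cl k) :=
  NormedAddCommGroup.induced (Cl k) (EuclideanSpace ℝ (Finset (Fin (k + 2)))) (coeffs k)
    (coeffs_injective k)

instance (k : ℕ) : NormedSpace ℝ (Cl k) :=
  NormedSpace.induced ℝ (Cl k) (EuclideanSpace ℝ (Finset (Fin (k + 2)))) (coeffs k)

theorem norm_eq (k : ℕ) (a : Cl k) :
    ‖a‖ = Real.sqrt (∑ A, (cliffordBasis k).repr a A ^ 2) := by
  change ‖coeffs k a‖ = _
  rw [EuclideanSpace.norm_eq]
  simp [coeffs]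

/-- The reflection preserves the quadratic form. -/
def reflIsometry (k : ℕ) : negForm k →qᵢ negForm k where
  toLinearMap := reflLast k
  map_app' x := by
    change negForm k (reflLast k x) = _
    rw [negForm_apply, negForm_apply, EuclideanSpace.norm_sq_eq, EuclideanSpace.norm_sq_eq]
    congr 1
    refine Finset.sum_congr rfl fun i _ => ?_
    by_cases h : i = lastIdx k <;> simp [reflLast, h]

/-- The automorphism `A ↦ Â` of `Cl_n` with `ê_j = e_j` for `j < n` and `ê_n = -e_n`. -/
def hat {k : ℕ} : Cl k →ₐ[ℝ] Cl k := CliffordAlgebra.map (reflIsometry k)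

/-- The subalgebra `Cl_{n-1}` generated by `e_1, …, e_{n-1}`. -/
def subCl (k : ℕ) : Subalgebra ℝ (Cl k) :=
  Algebra.adjoin ℝ {a | ∃ j : Fin (k + 2), j ≠ lastIdx k ∧ a = e j}

/-- The `P` part: `A = P A + (Q A) e_n`. -/
def projP {k : ℕ} (a : Cl k) : Cl k := (1 / 2 : ℝ) • (a + hat a)

/-- The `Q` part: `A = P A + (Q A) e_n`. -/
def projQ {k : ℕ} (a : Cl k) : Cl k := (-(1 / 2) : ℝ) • ((a - hat a) * eLast k)

theorem hat_e {k : ℕ} (j : Fin (k + 2)) :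
    hat (e j : Cl k) = if j = lastIdx k then -e j else e j := by
  rw [hat, e, vec, CliffordAlgebra.map_apply_ι]
  have h : reflIsometry k (EuclideanSpace.single j 1) =
      if j = lastIdx k then -EuclideanSpace.single j 1 else EuclideanSpace.single j 1 := by
    change reflLast k _ = _
    ext i
    by_cases hj : j = lastIdx k
    · by_cases hi : i = lastIdx k <;> simp [reflLast, hi, hj]
    · by_cases hi : i = lastIdx k
      · simp [reflLast, hi, hj, Ne.symm hj]
      · simp [reflLast, hi, hj]
  rw [h]
  split_ifs <;> simp

theorem hat_of_mem {k : ℕ} {b : Cl k} (hb : b ∈ subCl k) : hat b = b := by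
  have h : subCl k ≤ AlgHom.equalizer (hat (k := k)) (AlgHom.id ℝ (Cl k)) := by
    refine Algebra.adjoin_le ?_
    rintro _ ⟨j, hj, rfl⟩
    change hat (e j) = e j
    rw [hat_e, if_neg hj]
  exact h hb

theorem exists_decomposition {k : ℕ} (a : Cl k) :
    ∃ b ∈ subCl k, ∃ c ∈ subCl k, a = b + c * eLast k := by
  induction a using CliffordAlgebra.right_induction with
  | algebraMap r => exact ⟨_, Subalgebra.algebraMap_mem _ r, 0, zero_mem _, by simp⟩
  | add x y hx hy =>
    obtain ⟨b, hb, c, hc, rfl⟩ := hx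
    obtain ⟨b', hb', c', hc', rfl⟩ := hy
    exact ⟨b + b', add_mem hb hb', c + c', add_mem hc hc', by rw [add_mul]; abel⟩
  | mul_ι m x hx =>
    obtain ⟨b, hb, c, hc, rfl⟩ := hx
    have hm : CliffordAlgebra.ι (negForm k) m = ∑ j, m j • (e j : Cl k) := by
      conv_lhs => rw [← (EuclideanSpace.basisFun (Fin (k + 2)) ℝ).sum_repr m]
      simp [e]
    have hsub : ∀ j ∈ (Finset.univ.erase (lastIdx k)), (m j • (e j : Cl k)) ∈ subCl k := by
      intro j hj
      have h : (e j : Cl k) ∈ subCl k :=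
        Algebra.subset_adjoin ⟨j, (Finset.mem_erase.mp hj).1, rfl⟩
      exact Subalgebra.smul_mem _ h _
    have hs := sum_mem hsub
    have hcomm : eLast k * ∑ j ∈ Finset.univ.erase (lastIdx k), m j • (e j : Cl k) =
        -((∑ j ∈ Finset.univ.erase (lastIdx k), m j • (e j : Cl k)) * eLast k) := by
      rw [Finset.mul_sum, Finset.sum_mul, ← Finset.sum_neg_distrib]
      refine Finset.sum_congr rfl fun j hj => ?_
      rw [mul_smul_comm, smul_mul_assoc, e_mul_comm (Finset.mem_erase.mp hj).1.symm, smul_neg]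
    rw [hm, ← Finset.add_sum_erase _ _ (Finset.mem_univ (lastIdx k))]
    generalize (∑ j ∈ Finset.univ.erase (lastIdx k), m j • (e j : Cl k)) = s at hs hcomm
    refine ⟨b * s - m (lastIdx k) • c, sub_mem (mul_mem hb hs) (Subalgebra.smul_mem _ hc _),
      m (lastIdx k) • b - c * s, sub_mem (Subalgebra.smul_mem _ hb _) (mul_mem hc hs), ?_⟩
    have he := e_mul_self (lastIdx k)
    simp only [mul_add, add_mul, sub_mul, mul_smul_comm, smul_mul_assoc, mul_assoc, he, hcomm,
      mul_neg, mul_one, smul_add, smul_neg]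
    abel

theorem projP_projQ_of_decomposition {k : ℕ} {b c : Cl k} (hb : b ∈ subCl k) (hc : c ∈ subCl k) :
    projP (b + c * eLast k) = b ∧ projQ (b + c * eLast k) = c := by
  have hh : hat (b + c * eLast k) = b - c * eLast k := by
    rw [map_add, map_mul, hat_of_mem hb, hat_of_mem hc, hat_e, if_pos rfl, mul_neg, sub_eq_add_neg]
  constructor
  · rw [projP, hh, show b + c * eLast k + (b - c * eLast k) = (2 : ℝ) • b by rw [two_smul]; abel,
      smul_smul]
    norm_num
  · rw [projQ, hh, show b + c * eLast k - (b - c * eLast k) = (2 : ℝ) • (c * eLast k) by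
      rw [two_smul]; abel, smul_mul_assoc, mul_assoc, e_mul_self, smul_smul]
    norm_num

/-- `P A` and `Q A` are the unique elements of `Cl_{n-1}` with `A = P A + (Q A) e_n`. -/
theorem projP_projQ_spec {k : ℕ} (a : Cl k) :
    projP a ∈ subCl k ∧ projQ a ∈ subCl k ∧
      ∀ b ∈ subCl k, ∀ c ∈ subCl k, (a = b + c * eLast k ↔ b = projP a ∧ c = projQ a) := by
  obtain ⟨b, hb, c, hc, rfl⟩ := exists_decomposition a
  obtain ⟨h1, h2⟩ := projP_projQ_of_decomposition hb hc
  refine ⟨h1.symm ▸ hb, h2.symm ▸ hc, fun b' hb' c' hc' => ⟨fun h => ?_, fun h => ?_⟩⟩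
  · rw [h]
    obtain ⟨h3, h4⟩ := projP_projQ_of_decomposition hb' hc'
    exact ⟨h3.symm, h4.symm⟩
  · rw [h.1, h.2, h1, h2]

/-- `Q' A = -e_n (Q A) e_n`. -/
def projQ' {k : ℕ} (a : Cl k) : Cl k := -(eLast k * projQ a * eLast k)

/-- The Euclidean Dirac operator `D = Σ_j e_j ∂/∂x_j`. -/
def dirac {k : ℕ} (f : Space k → Cl k) (y : Space k) : Cl k :=
  ∑ j, e j * fderiv ℝ f y (EuclideanSpace.single j 1)

/-- The Dirac-Hodge operator `M f = D f + ((n - 2) / y_n) Q' f`, where `n - 2 = k`. -/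
def diracHodge {k : ℕ} (f : Space k → Cl k) (y : Space k) : Cl k :=
  dirac f y + ((k : ℝ) / y (lastIdx k)) • projQ' (f y)

/-- `E(x, y) = (x - y)⁻¹ / (‖x - y‖^{n-2} ‖x - ŷ‖^{n-2})`. -/
def kernelE {k : ℕ} (x y : Space k) : Cl k :=
  (‖x - y‖ ^ k * ‖x - reflLast k y‖ ^ k)⁻¹ • vecInv (x - y)

/-- `F(x, y) = (x̂ - y)⁻¹ / (‖x - y‖^{n-2} ‖x̂ - y‖^{n-2})`. -/
def kernelF {k : ℕ} (x y : Space k) : Cl k :=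
  (‖x - y‖ ^ k * ‖reflLast k x - y‖ ^ k)⁻¹ • vecInv (reflLast k x - y)

/-- `ω_n`, the surface area of the unit sphere of `R^n`. -/
def sphereArea (k : ℕ) : ℝ := (volume : Measure (Space k)).toSphere.real Set.univ

/-- The normalized potential
`I(y) = -(2^{n-2} y_n^{n-2} / ω_n) (∫_K E(x, y) L(x) dx - ∫_K F(x, y) L̂(x) dx)`. -/
def potential {k : ℕ} (K : Set (Space k)) (L : Space k → Cl k) (y : Space k) : Cl k :=
  (-(2 ^ k * y (lastIdx k) ^ k / sphereArea k)) •
    ((∫ x in K, kernelE x y * L x) - ∫ x in K, kernelF x y * hat (L x))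

/-- `L ∈ C¹(K̄)` for an open set `K`: `L` is continuous on the closure of `K`, it is differentiable
on `K`, and its derivative on `K` extends continuously to the closure of `K`. -/
def IsC1OnClosure {k : ℕ} (K : Set (Space k)) (L : Space k → Cl k) : Prop :=
  ContinuousOn L (closure K) ∧
    ∃ L' : Space k → (Space k →L[ℝ] Cl k), ContinuousOn L' (closure K) ∧
      ∀ x ∈ K, HasFDerivAt L (L' x) x

end

end DiracHodge

open DiracHodge

/-! Put n = k + 2, u = x - y, v = x̂ - y. Since ‖x - ŷ‖ = ‖v‖, multiplying E and F by (2 y_n)^k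
gives w u⁻¹/‖u‖^k and w v⁻¹/‖u‖^k, where w = (2 y_n)^k/‖v‖^k is smooth for x, y in the half space
and equals 1 on the diagonal. Thus E carries the singularity of the Euclidean Cauchy kernel, and F
only that of ‖u‖^(2-n).

Off the diagonal, M annihilates the kernel applied to any fixed density value. This is pure algebra:
the gradient of w, the gradient of ‖u‖^(-k), the derivative of v⁻¹ and the Q' term cancel, because
e_n turns the products u⁻¹v⁻¹ and v⁻¹u⁻¹ into differences of inverses (`kernel_identity`,
`kernelDirac_add_projQ'`). Hence M(I)(y) only sees the diagonal. There the Cauchy kernel, a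
fundamental solution of the Dirac operator (`sum_e_mul_integral_cauchy`), contributes -ω_n L(y), and
the prefactor -1/ω_n turns this into L(y).

To make this rigorous, L is cut into χL + (1 - χ)L with χ = 1 near y. The second density vanishes
near y, so one differentiates under the integral (`diracHodge_regular`). The first is C¹ with
compact support. The substitution x = z + y frees the singular kernel of y, so only the density is
differentiated (`hasFDerivAt_singular_integral`); the part of the derivative along z is then
integrated by parts against the kernel (`diracHodge_singular`). Integration by parts against the
singular kernels is the limit of that for (‖z‖² + ε²)^(-m/2), where the Dirac operator of the Cauchy
kernel becomes an approximate identity of mass ω_n. -/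

namespace DiracHodge

noncomputable section

open Filter Topology

/-! ### Clifford algebra: reflection, inverses of vectors and the cancellation identity. -/

/-- Clifford multiplication as a continuous bilinear map. -/
def mulL (k : ℕ) : Cl k →L[ℝ] Cl k →L[ℝ] Cl k :=
  LinearMap.toContinuousLinearMap
    (LinearMap.toContinuousLinearMap.toLinearMap ∘ₗ LinearMap.mul ℝ (Cl k))

@[simp] theorem mulL_apply {k : ℕ} (a b : Cl k) : mulL k a b = a * b := rfl

/-- The embedding of vectors as a continuous linear map. -/
def vecL (k : ℕ) : Space k →L[ℝ] Cl k :=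
  LinearMap.toContinuousLinearMap (CliffordAlgebra.ι (negForm k))

@[simp] theorem vecL_apply {k : ℕ} (x : Space k) : vecL k x = vec x := rfl

/-- The automorphism `hat` as a continuous linear map. -/
def hatL (k : ℕ) : Cl k →L[ℝ] Cl k := LinearMap.toContinuousLinearMap (hat (k := k)).toLinearMap

@[simp] theorem hatL_apply {k : ℕ} (a : Cl k) : hatL k a = hat a := rfl

/-- The reflection as a continuous linear map. -/
def reflL (k : ℕ) : Space k →L[ℝ] Space k := LinearMap.toContinuousLinearMap (reflLast k)

@[fun_prop] theorem continuous_hat {k : ℕ} : Continuous (hat : Cl k → Cl k) := (hatL k).continuous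

theorem norm_cl_mul_le {k : ℕ} (a b : Cl k) : ‖a * b‖ ≤ ‖mulL k‖ * ‖a‖ * ‖b‖ :=
  (mulL k).le_opNorm₂ a b

theorem reflLast_apply {k : ℕ} (x : Space k) (i : Fin (k + 2)) :
    reflLast k x i = if i = lastIdx k then -(x i) else x i := rfl

@[simp] theorem reflLast_reflLast {k : ℕ} (x : Space k) : reflLast k (reflLast k x) = x := by
  ext i
  by_cases h : i = lastIdx k <;> simp [reflLast_apply, h]

@[simp] theorem norm_reflLast {k : ℕ} (x : Space k) : ‖reflLast k x‖ = ‖x‖ := by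
  rw [EuclideanSpace.norm_eq, EuclideanSpace.norm_eq]
  congr 1
  refine Finset.sum_congr rfl fun i _ => ?_
  by_cases h : i = lastIdx k <;> simp [reflLast_apply, h]

theorem norm_sub_reflLast {k : ℕ} (x y : Space k) : ‖x - reflLast k y‖ = ‖reflLast k x - y‖ := by
  rw [← norm_reflLast, map_sub, reflLast_reflLast]

theorem sub_reflLast_self {k : ℕ} (y : Space k) :
    y - reflLast k y = (2 * y (lastIdx k)) • EuclideanSpace.single (lastIdx k) (1 : ℝ) := by
  ext i
  by_cases h : i = lastIdx k
  · subst h; simp [reflLast_apply]; ring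
  · simp [reflLast_apply, h]

theorem hat_vec {k : ℕ} (x : Space k) : hat (vec x) = vec (reflLast k x) := by
  rw [hat, vec, CliffordAlgebra.map_apply_ι]; rfl

theorem hat_vecInv {k : ℕ} (x : Space k) : hat (vecInv x) = vecInv (reflLast k x) := by
  rw [vecInv, vecInv, map_smul, hat_vec, norm_reflLast]

@[simp] theorem hat_hat {k : ℕ} (a : Cl k) : hat (hat a) = a := by
  induction a using CliffordAlgebra.induction with
  | algebraMap r => simp
  | ι x => rw [← vec, hat_vec, hat_vec, reflLast_reflLast]
  | mul a b ha hb => rw [map_mul, map_mul, ha, hb]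
  | add a b ha hb => rw [map_add, map_add, ha, hb]

theorem projQ'_eq {k : ℕ} (a : Cl k) : projQ' a = -(1 / 2 : ℝ) • (eLast k * (a - hat a)) := by
  rw [projQ', projQ]
  simp only [mul_smul_comm, smul_mul_assoc, mul_assoc, e_mul_self, mul_neg, mul_one, smul_neg,
    neg_smul, neg_mul, neg_neg]

theorem vec_sum {k : ℕ} (x : Space k) : vec x = ∑ j, x j • (e j : Cl k) := by
  conv_lhs => rw [← (EuclideanSpace.basisFun (Fin (k + 2)) ℝ).sum_repr x]
  simp [e]

/-- e_n anticommutes with the other generators and squares to -1, so sandwiching between two e_n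
fixes e_j for j < n and flips e_n. -/
theorem eLast_mul_vec_mul_eLast {k : ℕ} (w : Space k) :
    eLast k * vec w * eLast k = vec (reflLast k w) := by
  rw [vec_sum, vec_sum, Finset.mul_sum, Finset.sum_mul]
  refine Finset.sum_congr rfl fun j _ => ?_
  rw [mul_smul_comm, smul_mul_assoc, reflLast_apply]
  by_cases h : j = lastIdx k
  · subst h
    rw [if_pos rfl, e_mul_self, neg_one_mul, smul_neg, neg_smul]
  · rw [if_neg h, e_mul_comm (Ne.symm h), neg_mul, mul_assoc, e_mul_self, mul_neg, mul_one,
      neg_neg]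

theorem eLast_mul_vecInv_mul_eLast {k : ℕ} (w : Space k) :
    eLast k * vecInv w * eLast k = vecInv (reflLast k w) := by
  rw [vecInv, mul_smul_comm, smul_mul_assoc, eLast_mul_vec_mul_eLast, vecInv, norm_reflLast]

/-- Resolvent identity p⁻¹ - q⁻¹ = q⁻¹(q - p)p⁻¹. When q - p is a multiple of e_n, the factor e_n on
the left completes the sandwich e_n q⁻¹ e_n, which is the inverse of the reflected vector. -/
theorem eLast_mul_vecInv_sub_vecInv {k : ℕ} {p q : Space k} (hp : p ≠ 0) (hq : q ≠ 0) {t : ℝ}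
    (h : q - p = t • EuclideanSpace.single (lastIdx k) (1 : ℝ)) :
    eLast k * (vecInv p - vecInv q) = t • (vecInv (reflLast k q) * vecInv p) := by
  have h1 : vecInv p - vecInv q = vecInv q * (vec q - vec p) * vecInv p := by
    rw [mul_sub, sub_mul, (vec_mul_vecInv hq).2, mul_assoc, (vec_mul_vecInv hp).1, one_mul,
      mul_one]
  have h2 : vec q - vec p = t • eLast k := by
    rw [← vecL_apply, ← vecL_apply, ← map_sub, h, map_smul]; rfl
  rw [h1, h2, ← eLast_mul_vecInv_mul_eLast]
  simp only [mul_smul_comm, smul_mul_assoc, mul_assoc]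

theorem vecInv_mul_self {k : ℕ} (v : Space k) :
    vecInv v * vecInv v = (-(‖v‖ ^ 2)⁻¹) • (1 : Cl k) := by
  by_cases hv : v = 0
  · simp [hv, vecInv]
  · conv_lhs => rw [vecInv, smul_mul_assoc, ← vecInv, (vec_mul_vecInv hv).1]

/-- The Clifford identity behind the Dirac-Hodge nullity of the kernel. -/
theorem kernel_identity {k : ℕ} {x y : Space k} (hy : y (lastIdx k) ≠ 0) (hu : x - y ≠ 0)
    (hv : reflLast k x - y ≠ 0) (a : Cl k) :
    (y (lastIdx k))⁻¹ • (eLast k * (vecInv (x - y) * a - vecInv (reflLast k x - y) * hat a))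
      - vecInv (reflLast k x - y) * (vecInv (x - y) * a - vecInv (reflLast k x - y) * hat a)
      + (vecInv (x - y) * vecInv (reflLast k x - y) * hat a
        - vecInv (reflLast k x - y) * vecInv (reflLast k x - y) * hat a)
      + (y (lastIdx k))⁻¹ •
        projQ' (vecInv (x - y) * a - vecInv (reflLast k x - y) * hat a) = 0 := by
  have hu' : reflLast k (x - y) ≠ 0 := by
    rw [← norm_ne_zero_iff, norm_reflLast, norm_ne_zero_iff]; exact hu
  have hv' : reflLast k (reflLast k x - y) ≠ 0 := by
    rw [← norm_ne_zero_iff, norm_reflLast, norm_ne_zero_iff]; exact hv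
  -- With u = x - y and v = x̂ - y, both v̂ - u and û - v equal y - ŷ = 2 y_n e_n, so the resolvent
  -- identity applies to each pair.
  have h1 := eLast_mul_vecInv_sub_vecInv (t := 2 * y (lastIdx k)) hu hv' (by
    rw [map_sub, reflLast_reflLast, ← sub_reflLast_self]; abel)
  have h2 := eLast_mul_vecInv_sub_vecInv (t := 2 * y (lastIdx k)) hv hu' (by
    rw [map_sub, ← sub_reflLast_self]; abel)
  rw [reflLast_reflLast] at h1 h2
  have h3 : vecInv (reflLast k x - y) * vecInv (x - y) = ((2 * y (lastIdx k))⁻¹) •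
      (eLast k * (vecInv (x - y) - vecInv (reflLast k (reflLast k x - y)))) := by
    rw [h1, smul_smul, inv_mul_cancel₀ (by simpa using hy), one_smul]
  have h4 : vecInv (x - y) * vecInv (reflLast k x - y) = ((2 * y (lastIdx k))⁻¹) •
      (eLast k * (vecInv (reflLast k x - y) - vecInv (reflLast k (x - y)))) := by
    rw [h2, smul_smul, inv_mul_cancel₀ (by simpa using hy), one_smul]
  -- The two v⁻¹v⁻¹ terms cancel. Once the mixed products are linear in the inverses, only e_n u⁻¹a,
  -- e_n v̂⁻¹a, e_n v⁻¹â and e_n û⁻¹â remain, each with total coefficient zero.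
  rw [mul_sub (vecInv (reflLast k x - y)), ← mul_assoc (vecInv (reflLast k x - y)) (vecInv (x - y)),
    ← mul_assoc (vecInv (reflLast k x - y)) (vecInv (reflLast k x - y)), h3, h4, projQ'_eq]
  simp only [map_sub, map_mul, hat_hat, hat_vecInv, mul_sub, sub_mul, smul_sub, smul_mul_assoc,
    mul_assoc, smul_smul, mul_inv, reflLast_reflLast]
  module

/-! ### The Dirac symbol on derivatives. -/

/-- `Σ_j e_j φ(e_j)`, the Dirac symbol applied to a derivative. -/
def diracSum {k : ℕ} (φ : Space k →L[ℝ] Cl k) : Cl k :=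
  ∑ j, e j * φ (EuclideanSpace.single j 1)

theorem dirac_eq {k : ℕ} (f : Space k → Cl k) (y : Space k) :
    dirac f y = diracSum (fderiv ℝ f y) := rfl

/-- `diracSum` as a continuous linear map. -/
def diracSumL (k : ℕ) : (Space k →L[ℝ] Cl k) →L[ℝ] Cl k :=
  ∑ j, (mulL k (e j)) ∘L (ContinuousLinearMap.apply ℝ (Cl k) (EuclideanSpace.single j 1))

@[simp] theorem diracSumL_apply {k : ℕ} (φ : Space k →L[ℝ] Cl k) :
    diracSumL k φ = diracSum φ := by
  simp [diracSumL, diracSum]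

theorem diracSum_smulRight {k : ℕ} (w : Space k) (a : Cl k) :
    diracSum ((innerSL ℝ w).smulRight a) = vec w * a := by
  rw [vec_sum, Finset.sum_mul, diracSum]
  refine Finset.sum_congr rfl fun j _ => ?_
  simp [EuclideanSpace.inner_single_right]

theorem diracSum_vecL {k : ℕ} : diracSum (vecL k) = (-((k : ℝ) + 2)) • (1 : Cl k) := by
  have : ∀ j : Fin (k + 2), (e j : Cl k) * vec (EuclideanSpace.single j 1) = -1 := e_mul_self
  simp only [diracSum, vecL_apply, this]
  rw [Finset.sum_const, Finset.card_univ, Fintype.card_fin, ← Nat.cast_smul_eq_nsmul ℝ]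
  push_cast
  module

theorem diracSum_mulRight {k : ℕ} (φ : Space k →L[ℝ] Cl k) (a : Cl k) :
    diracSum ((mulL k).flip a ∘L φ) = diracSum φ * a := by
  simp [diracSum, Finset.sum_mul, mul_assoc]

/-! ### Regularized kernels and their derivatives. -/

/-- The regularized power `(‖z‖² + ε²)^{-m/2}` of the norm. -/
def invPow {k : ℕ} (m : ℕ) (ε : ℝ) (z : Space k) : ℝ := (‖z‖ ^ 2 + ε ^ 2) ^ (-(m : ℝ) / 2)

theorem sq_rpow_neg_half (m : ℕ) {r : ℝ} (hr : 0 ≤ r) : (r ^ 2) ^ (-(m : ℝ) / 2) = (r ^ m)⁻¹ := by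
  rw [← Real.rpow_natCast_mul hr, ← Real.rpow_natCast r m, ← Real.rpow_neg hr]
  congr 1
  push_cast
  ring

theorem invPow_zero {k : ℕ} (m : ℕ) (z : Space k) : invPow m 0 z = (‖z‖ ^ m)⁻¹ := by
  rw [invPow, ← sq_rpow_neg_half m (norm_nonneg z)]
  simp

theorem invPow_nonneg {k : ℕ} (m : ℕ) (ε : ℝ) (z : Space k) : 0 ≤ invPow m ε z := by
  unfold invPow; positivity

theorem invPow_le {k : ℕ} (m : ℕ) (ε : ℝ) {z : Space k} (hz : z ≠ 0) :
    invPow m ε z ≤ invPow m 0 z := by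
  have : 0 < ‖z‖ := norm_pos_iff.mpr hz
  refine Real.rpow_le_rpow_of_nonpos (by positivity) (by nlinarith [sq_nonneg ε]) ?_
  have : (0 : ℝ) ≤ m := by positivity
  linarith

theorem invPow_add_two {k : ℕ} (m : ℕ) {ε : ℝ} {z : Space k} (h : 0 < ‖z‖ ^ 2 + ε ^ 2) :
    (‖z‖ ^ 2 + ε ^ 2) * invPow (m + 2) ε z = invPow m ε z := by
  rw [invPow, invPow, show -((m + 2 : ℕ) : ℝ) / 2 = -(m : ℝ) / 2 - 1 by push_cast; ring,
    Real.rpow_sub_one h.ne', mul_div_cancel₀ _ h.ne']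

theorem hasFDerivAt_invPow {k : ℕ} (m : ℕ) {ε : ℝ} {z : Space k} (h : 0 < ‖z‖ ^ 2 + ε ^ 2) :
    HasFDerivAt (invPow m ε) ((-(m * invPow (m + 2) ε z)) • innerSL ℝ z) z := by
  have h1 := (((hasStrictFDerivAt_norm_sq z).hasFDerivAt.add_const (ε ^ 2)).rpow_const
    (p := -(m : ℝ) / 2) (Or.inl h.ne'))
  refine h1.congr_fderiv ?_
  rw [← Nat.cast_smul_eq_nsmul ℝ, smul_smul, invPow]
  congr 1
  rw [show -((m + 2 : ℕ) : ℝ) / 2 = -(m : ℝ) / 2 - 1 by push_cast; ring]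
  push_cast
  ring

theorem contDiff_invPow {k : ℕ} (m : ℕ) {ε : ℝ} (hε : ε ≠ 0) :
    ContDiff ℝ 1 (invPow m ε : Space k → ℝ) := by
  unfold invPow
  refine ContDiff.rpow_const_of_ne ((contDiff_norm_sq ℝ).add contDiff_const) fun z => ?_
  positivity

theorem contDiffAt_invPow {k : ℕ} (m : ℕ) {ε : ℝ} {z : Space k} (h : 0 < ‖z‖ ^ 2 + ε ^ 2) :
    ContDiffAt ℝ 1 (invPow m ε : Space k → ℝ) z := by
  unfold invPow
  exact ((contDiff_norm_sq ℝ).contDiffAt.add contDiffAt_const).rpow_const_of_ne h.ne'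

theorem tendsto_invPow {k : ℕ} (m : ℕ) {z : Space k} (hz : z ≠ 0) :
    Tendsto (fun c : ℝ => invPow m c⁻¹ z) atTop (𝓝 (invPow m 0 z)) := by
  have h0 : 0 < ‖z‖ := norm_pos_iff.mpr hz
  have h : ContinuousAt (fun ε : ℝ => invPow m ε z) 0 := by
    unfold invPow
    refine ContinuousAt.rpow_const (by fun_prop) (Or.inl ?_)
    positivity
  exact h.tendsto.comp tendsto_inv_atTop_zero

/-- Homogeneity of (‖z‖² + ε²)^(-m/2) under joint scaling of z and ε. The parameter is c = 1/ε → ∞,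
so that the regularized Dirac derivatives take the form cⁿ φ(c z) of an approximate identity. -/
theorem invPow_smul {k : ℕ} (m : ℕ) {c : ℝ} (hc : 0 < c) (z : Space k) :
    invPow m c⁻¹ z = c ^ m * invPow m 1 (c • z) := by
  have h : ‖z‖ ^ 2 + c⁻¹ ^ 2 = c⁻¹ ^ 2 * (‖c • z‖ ^ 2 + 1 ^ 2) := by
    rw [norm_smul, Real.norm_of_nonneg hc.le]
    field_simp
  rw [invPow, h, Real.mul_rpow (by positivity) (by positivity), sq_rpow_neg_half m (by positivity),
    invPow]
  simp

/-- The regularized Cauchy kernel `-z (‖z‖² + ε²)^{-n/2}`; for `ε = 0` it is the Cauchy kernel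
`z⁻¹ / ‖z‖^{n-2}`. -/
def cauchy {k : ℕ} (ε : ℝ) (z : Space k) : Cl k := (-invPow (k + 2) ε z) • vec z

theorem cauchy_zero {k : ℕ} (z : Space k) : cauchy 0 z = (‖z‖ ^ k)⁻¹ • vecInv z := by
  rw [cauchy, vecInv, smul_smul, invPow_zero, pow_add, mul_inv, mul_neg]

/-- The regularized scalar kernel `(‖z‖² + ε²)^{-(n-2)/2}`. -/
def newton {k : ℕ} (ε : ℝ) (z : Space k) : Cl k := invPow k ε z • 1

theorem contDiff_cauchy {k : ℕ} {ε : ℝ} (hε : ε ≠ 0) : ContDiff ℝ 1 (cauchy ε : Space k → Cl k) :=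
  (contDiff_invPow _ hε).neg.smul (vecL k).contDiff

theorem contDiff_newton {k : ℕ} {ε : ℝ} (hε : ε ≠ 0) : ContDiff ℝ 1 (newton ε : Space k → Cl k) :=
  (contDiff_invPow k hε).smul (contDiff_const (c := (1 : Cl k)))

theorem hasFDerivAt_newton {k : ℕ} {ε : ℝ} {z : Space k} (h : 0 < ‖z‖ ^ 2 + ε ^ 2) :
    HasFDerivAt (newton ε) ((innerSL ℝ z).smulRight ((-(k * invPow (k + 2) ε z)) • (1 : Cl k)))
      z := by
  refine ((hasFDerivAt_invPow k h).smul_const (1 : Cl k)).congr_fderiv ?_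
  ext v
  simp [smul_smul, mul_comm]

theorem diracSum_fderiv_newton {k : ℕ} {ε : ℝ} {z : Space k} (h : 0 < ‖z‖ ^ 2 + ε ^ 2) :
    diracSum (fderiv ℝ (newton ε) z) = (k : ℝ) • cauchy ε z := by
  rw [(hasFDerivAt_newton h).fderiv, diracSum_smulRight, cauchy, mul_smul_comm, mul_one, smul_smul,
    mul_neg]

theorem hasFDerivAt_cauchy {k : ℕ} {ε : ℝ} {z : Space k} (h : 0 < ‖z‖ ^ 2 + ε ^ 2) :
    HasFDerivAt (cauchy ε) ((-invPow (k + 2) ε z) • vecL k +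
      (innerSL ℝ z).smulRight (((k + 2 : ℕ) * invPow (k + 4) ε z) • vec z)) z := by
  refine ((hasFDerivAt_invPow (k + 2) h).neg.smul (vecL k).hasFDerivAt).congr_fderiv ?_
  ext v
  simp [smul_smul, mul_comm]

/-- Both terms carry (n)(‖z‖² + ε²)^(-n/2-1): differentiating the vector gives the factor ‖z‖² + ε²,
differentiating the scalar gives -‖z‖². Only ε² survives, and it concentrates at the origin as ε →
0. -/
theorem diracSum_fderiv_cauchy {k : ℕ} {ε : ℝ} {z : Space k} (h : 0 < ‖z‖ ^ 2 + ε ^ 2) :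
    diracSum (fderiv ℝ (cauchy ε) z) =
      (((k : ℝ) + 2) * ε ^ 2 * invPow (k + 4) ε z) • (1 : Cl k) := by
  rw [(hasFDerivAt_cauchy h).fderiv, ← diracSumL_apply, map_add, map_smul, diracSumL_apply,
    diracSumL_apply, diracSum_smulRight, diracSum_vecL, mul_smul_comm, vec_mul_self,
    ← invPow_add_two (k + 2) h, smul_smul, smul_smul, ← add_smul]
  congr 1
  push_cast
  ring

/-! ### Local integrability of the singular kernels and passage to the limit ε → 0. -/

theorem ae_ne_zero {k : ℕ} : ∀ᵐ z : Space k, z ≠ 0 := by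
  simp [ae_iff]

theorem aestronglyMeasurable_of_tendsto_inv {k : ℕ} {f : ℝ → Space k → Cl k}
    (hf : ∀ c : ℝ, 0 < c → Continuous (f c⁻¹))
    (h : ∀ z, z ≠ 0 → Tendsto (fun c : ℝ => f c⁻¹ z) atTop (𝓝 (f 0 z))) :
    AEStronglyMeasurable (f 0) := by
  refine aestronglyMeasurable_of_tendsto_ae (atTop : Filter ℕ)
    (f := fun m : ℕ => f ((m : ℝ) + 1)⁻¹)
    (fun m => (hf _ (by positivity)).aestronglyMeasurable) ?_
  filter_upwards [ae_ne_zero] with z hz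
  exact (h z hz).comp (tendsto_atTop_add_const_right _ 1 tendsto_natCast_atTop_atTop)

theorem tendsto_cauchy {k : ℕ} {z : Space k} (hz : z ≠ 0) :
    Tendsto (fun c : ℝ => cauchy c⁻¹ z) atTop (𝓝 (cauchy 0 z)) :=
  (tendsto_invPow _ hz).neg.smul_const _

theorem tendsto_newton {k : ℕ} {z : Space k} (hz : z ≠ 0) :
    Tendsto (fun c : ℝ => newton c⁻¹ z) atTop (𝓝 (newton 0 z)) :=
  (tendsto_invPow _ hz).smul_const _

theorem norm_cauchy_le {k : ℕ} (ε : ℝ) {z : Space k} (hz : z ≠ 0) :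
    ‖cauchy ε z‖ ≤ ‖cauchy 0 z‖ := by
  rw [cauchy, cauchy, norm_smul, norm_smul, norm_neg, norm_neg,
    Real.norm_of_nonneg (invPow_nonneg ..), Real.norm_of_nonneg (invPow_nonneg ..)]
  exact mul_le_mul_of_nonneg_right (invPow_le _ _ hz) (norm_nonneg _)

theorem norm_newton_le {k : ℕ} (ε : ℝ) {z : Space k} (hz : z ≠ 0) :
    ‖newton ε z‖ ≤ ‖newton 0 z‖ := by
  rw [newton, newton, norm_smul, norm_smul,
    Real.norm_of_nonneg (invPow_nonneg ..), Real.norm_of_nonneg (invPow_nonneg ..)]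
  exact mul_le_mul_of_nonneg_right (invPow_le _ _ hz) (norm_nonneg _)

theorem inv_norm_pow_eq_rpow {k : ℕ} (m : ℕ) (z : Space k) :
    (‖z‖ ^ m)⁻¹ = ‖z‖ ^ (-(m : ℝ)) := by
  rw [Real.rpow_neg (norm_nonneg z), Real.rpow_natCast]

theorem locallyIntegrable_cauchy {k : ℕ} : LocallyIntegrable (cauchy 0 : Space k → Cl k) := by
  -- The Cauchy kernel has size ‖z‖^(-(n-1)), just below the critical exponent n = k + 2.
  refine locallyIntegrable_of_norm_le_rpow (C := ‖vecL k‖) (α := ((k + 1 : ℕ) : ℝ)) (by simp)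
    (by simp) (Filter.Eventually.of_forall fun z => ?_)
    (aestronglyMeasurable_of_tendsto_inv (fun c hc => (contDiff_cauchy (by positivity)).continuous)
      fun z hz => tendsto_cauchy hz)
  rw [cauchy, norm_smul, norm_neg, Real.norm_of_nonneg (invPow_nonneg ..), invPow_zero,
    ← inv_norm_pow_eq_rpow]
  have h := (vecL k).le_opNorm z
  rw [vecL_apply] at h
  by_cases hz : z = 0
  · simp [hz]
  · have h0 : 0 < ‖z‖ := norm_pos_iff.mpr hz
    calc (‖z‖ ^ (k + 2))⁻¹ * ‖vec z‖ ≤ (‖z‖ ^ (k + 2))⁻¹ * (‖vecL k‖ * ‖z‖) := by gcongr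
      _ = _ := by field_simp; ring

theorem locallyIntegrable_newton {k : ℕ} : LocallyIntegrable (newton 0 : Space k → Cl k) := by
  refine locallyIntegrable_of_norm_le_rpow (C := ‖(1 : Cl k)‖) (α := ((k : ℕ) : ℝ)) (by simp)
    (by simp) (Filter.Eventually.of_forall fun z => ?_)
    (aestronglyMeasurable_of_tendsto_inv (fun c hc => (contDiff_newton (by positivity)).continuous)
      fun z hz => tendsto_newton hz)
  rw [newton, norm_smul, Real.norm_of_nonneg (invPow_nonneg ..), invPow_zero,
    ← inv_norm_pow_eq_rpow, mul_comm]

theorem aestronglyMeasurable_cl_mul {k : ℕ} {α : Type*} [MeasurableSpace α] {μ : Measure α}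
    {f g : α → Cl k} (hf : AEStronglyMeasurable f μ) (hg : AEStronglyMeasurable g μ) :
    AEStronglyMeasurable (fun x => f x * g x) μ :=
  (mulL k).aestronglyMeasurable_comp₂ hf hg

theorem continuous_cl_mul {k : ℕ} {α : Type*} [TopologicalSpace α] {f g : α → Cl k}
    (hf : Continuous f) (hg : Continuous g) : Continuous (fun x => f x * g x) :=
  (mulL k).continuous₂.comp (hf.prodMk hg)

theorem integrableOn_cl_mul {k : ℕ} {κ h : Space k → Cl k} (hκ : LocallyIntegrable κ)
    {C : Set (Space k)} (hC : IsCompact C) (hh : ContinuousOn h C) :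
    IntegrableOn (fun z => κ z * h z) C := by
  obtain ⟨M, hM⟩ := hC.exists_bound_of_continuousOn hh
  have h1 : IntegrableOn κ C := hκ.integrableOn_isCompact hC
  refine Integrable.mono' (g := fun z => ‖mulL k‖ * ‖κ z‖ * M) ((h1.norm.const_mul _).mul_const _)
    (aestronglyMeasurable_cl_mul h1.1 (hh.aestronglyMeasurable hC.isClosed.measurableSet)) ?_
  filter_upwards [ae_restrict_mem hC.isClosed.measurableSet] with z hz
  exact (norm_cl_mul_le _ _).trans (mul_le_mul_of_nonneg_left (hM z hz) (by positivity))

theorem integrable_cl_mul {k : ℕ} {κ h : Space k → Cl k} (hκ : LocallyIntegrable κ)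
    (hh : Continuous h) (hc : HasCompactSupport h) : Integrable (fun z => κ z * h z) := by
  rw [← integrableOn_iff_integrable_of_support_subset (s := tsupport h)]
  · exact integrableOn_cl_mul hκ hc hh.continuousOn
  · intro z hz
    refine subset_tsupport _ fun h0 => hz ?_
    simp [h0]

theorem locallyIntegrable_comp_sub_right {k : ℕ} {κ : Space k → Cl k} (hκ : LocallyIntegrable κ)
    (y : Space k) : LocallyIntegrable (fun x => κ (x - y)) := by
  have h := locallyIntegrable_map_homeomorph (Homeomorph.subRight y) (f := κ)
    (μ := (volume : Measure (Space k)))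
  rw [Homeomorph.coe_subRight, map_sub_right_eq_self] at h
  exact h.mp hκ

/-- Dominated convergence: regularization only decreases the norm, so the singular kernel itself is
the majorant, integrable against a bounded density of compact support. -/
theorem tendsto_integral_cl_mul {k : ℕ} {f : ℝ → Space k → Cl k} {h : Space k → Cl k}
    (h0 : LocallyIntegrable (f 0)) (hf : ∀ c : ℝ, 0 < c → Continuous (f c⁻¹))
    (hlim : ∀ z, z ≠ 0 → Tendsto (fun c : ℝ => f c⁻¹ z) atTop (𝓝 (f 0 z)))
    (hle : ∀ ε z, z ≠ 0 → ‖f ε z‖ ≤ ‖f 0 z‖) (hh : Continuous h) (hc : HasCompactSupport h) :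
    Tendsto (fun c : ℝ => ∫ z, f c⁻¹ z * h z) atTop (𝓝 (∫ z, f 0 z * h z)) := by
  obtain ⟨M, hM⟩ := hc.exists_bound_of_continuous hh
  have hint : Integrable fun z => ‖f 0 z‖ * ‖h z‖ := by
    have h1 := LocallyIntegrable.integrable_smul_right_of_hasCompactSupport
      (fun x => (h0 x).norm) hh.norm hc.norm
    exact h1.congr (Eventually.of_forall fun z => by simp [mul_comm])
  refine tendsto_integral_filter_of_dominated_convergence
    (fun z => ‖mulL k‖ * (‖f 0 z‖ * ‖h z‖)) ?_ ?_ (hint.const_mul _) ?_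
  · filter_upwards [eventually_gt_atTop 0] with c hc
    exact (continuous_cl_mul (hf c hc) hh).aestronglyMeasurable
  · refine Eventually.of_forall fun c => ?_
    filter_upwards [ae_ne_zero] with z hz
    refine (norm_cl_mul_le _ _).trans ?_
    rw [mul_assoc]
    have := hle c⁻¹ z hz
    gcongr
  · filter_upwards [ae_ne_zero] with z hz
    exact ((mulL k).flip (h z)).continuous.continuousAt.tendsto.comp (hlim z hz)

/-! ### Weak Dirac derivatives of the kernels. -/

/-- Integration by parts for the Dirac operator. -/
theorem sum_e_mul_integral_mul_fderiv {k : ℕ} {f h : Space k → Cl k} (hf : ContDiff ℝ 1 f)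
    (hh : ContDiff ℝ 1 h) (hc : HasCompactSupport h) :
    ∑ j, e j * ∫ z, f z * fderiv ℝ h z (EuclideanSpace.single j 1) =
      -∫ z, diracSum (fderiv ℝ f z) * h z := by
  have hf' : Continuous (fderiv ℝ f) := hf.continuous_fderiv one_ne_zero
  have hh' : Continuous (fderiv ℝ h) := hh.continuous_fderiv one_ne_zero
  have i1 : ∀ v, Integrable (fun z => fderiv ℝ f z v * h z) := fun v =>
    integrable_cl_mul (hf'.clm_apply continuous_const).locallyIntegrable hh.continuous hc
  have key : ∀ j : Fin (k + 2), e j * ∫ z, f z * fderiv ℝ h z (EuclideanSpace.single j 1) =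
      -∫ z, e j * (fderiv ℝ f z (EuclideanSpace.single j 1) * h z) := by
    intro j
    have := integral_bilinear_fderiv_right_eq_neg_left_of_integrable (B := mulL k)
      (v := EuclideanSpace.single j (1 : ℝ)) (f := f) (g := h) (μ := volume) (i1 _)
      (integrable_cl_mul hf.continuous.locallyIntegrable (hh'.clm_apply continuous_const)
        (hc.fderiv_apply ℝ _))
      (integrable_cl_mul hf.continuous.locallyIntegrable hh.continuous hc)
      (fun z _ => hf.differentiable one_ne_zero z) (fun z _ => hh.differentiable one_ne_zero z)
    simp only [mulL_apply] at this
    rw [this, mul_neg]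
    congr 1
    exact ((mulL k (e j)).integral_comp_comm (i1 _)).symm
  rw [Finset.sum_congr rfl fun j _ => key j, Finset.sum_neg_distrib, ← integral_finsetSum]
  · congr 2
    ext1 z
    simp only [diracSum, Finset.sum_mul, mul_assoc]
  · exact fun j _ => (mulL k (e j)).integrable_comp (i1 _)

theorem tendsto_sum_e_mul_integral {k : ℕ} {f : ℝ → Space k → Cl k} {h : Space k → Cl k}
    (h0 : LocallyIntegrable (f 0)) (hf : ∀ c : ℝ, 0 < c → Continuous (f c⁻¹))
    (hlim : ∀ z, z ≠ 0 → Tendsto (fun c : ℝ => f c⁻¹ z) atTop (𝓝 (f 0 z)))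
    (hle : ∀ ε z, z ≠ 0 → ‖f ε z‖ ≤ ‖f 0 z‖) (hh : ContDiff ℝ 1 h) (hc : HasCompactSupport h) :
    Tendsto (fun c : ℝ => ∑ j, e j * ∫ z, f c⁻¹ z * fderiv ℝ h z (EuclideanSpace.single j 1))
      atTop (𝓝 (∑ j, e j * ∫ z, f 0 z * fderiv ℝ h z (EuclideanSpace.single j 1))) := by
  refine tendsto_finsetSum _ fun j _ => ?_
  exact (mulL k (e j)).continuous.continuousAt.tendsto.comp (tendsto_integral_cl_mul h0 hf hlim hle
    ((hh.continuous_fderiv one_ne_zero).clm_apply continuous_const) (hc.fderiv_apply ℝ _))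

theorem pos_of_inv_pos {k : ℕ} {c : ℝ} (hc : 0 < c) (z : Space k) : 0 < ‖z‖ ^ 2 + c⁻¹ ^ 2 := by
  positivity

/-- The singularity ‖z‖^(-(n-2)) is too weak to produce a point mass: the weak Dirac derivative is
the locally integrable function k times the Cauchy kernel. -/
theorem sum_e_mul_integral_newton {k : ℕ} {h : Space k → Cl k} (hh : ContDiff ℝ 1 h)
    (hc : HasCompactSupport h) :
    ∑ j, e j * ∫ z, newton 0 z * fderiv ℝ h z (EuclideanSpace.single j 1) =
      -((k : ℝ) • ∫ z, cauchy 0 z * h z) := by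
  refine tendsto_nhds_unique (tendsto_sum_e_mul_integral locallyIntegrable_newton
    (fun c hc => (contDiff_newton (by positivity)).continuous) (fun z hz => tendsto_newton hz)
    (fun ε z hz => norm_newton_le ε hz) hh hc) ?_
  have h1 := (tendsto_integral_cl_mul locallyIntegrable_cauchy
    (fun c hc => (contDiff_cauchy (by positivity)).continuous) (fun z hz => tendsto_cauchy hz)
    (fun ε z hz => norm_cauchy_le ε hz) hh.continuous hc).const_smul (k : ℝ)
  refine h1.neg.congr' ?_
  filter_upwards [eventually_gt_atTop 0] with c hc0
  rw [sum_e_mul_integral_mul_fderiv (contDiff_newton (by positivity)) hh hc, ← integral_smul]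
  congr 2
  ext1 z
  rw [diracSum_fderiv_newton (pos_of_inv_pos hc0 z), smul_mul_assoc]

/-- The approximate identity `n (1 + ‖z‖²)^{-n/2-1}`, normalized by the area of the sphere. -/
def bump (k : ℕ) (z : Space k) : ℝ := (sphereArea k)⁻¹ * (((k : ℝ) + 2) * invPow (k + 4) 1 z)

theorem sphereArea_pos (k : ℕ) : 0 < sphereArea k := by
  rw [sphereArea, Measure.toSphere_real_apply_univ]
  have : 0 < (volume : Measure (Space k)).real (Metric.ball 0 1) :=
    ENNReal.toReal_pos (Metric.measure_ball_pos _ _ one_pos).ne' measure_ball_lt_top.ne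
  simp
  positivity

/-- An explicit primitive of the radial density r^(n-1) n (r² + 1)^(-n/2-1). It increases from 0 to
1, so in polar coordinates the unnormalized mass is exactly ω_n. -/
theorem hasDerivAt_radial (k : ℕ) (r : ℝ) :
    HasDerivAt (fun r : ℝ => r ^ (k + 2) * (r ^ 2 + 1 ^ 2) ^ (-((k + 2 : ℕ) : ℝ) / 2))
      (r ^ (k + 1) * (((k : ℝ) + 2) * (r ^ 2 + 1 ^ 2) ^ (-((k + 4 : ℕ) : ℝ) / 2))) r := by
  have h0 : r ^ 2 + 1 ^ 2 ≠ 0 := by positivity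
  have h := (hasDerivAt_pow (k + 2) r).mul
    (((hasDerivAt_pow 2 r).add_const (1 ^ 2)).rpow_const (p := -((k + 2 : ℕ) : ℝ) / 2) (Or.inl h0))
  refine h.congr_deriv ?_
  have e1 : (r ^ 2 + 1 ^ 2) ^ (-((k + 2 : ℕ) : ℝ) / 2) =
      (r ^ 2 + 1 ^ 2) * (r ^ 2 + 1 ^ 2) ^ (-((k + 4 : ℕ) : ℝ) / 2) := by
    rw [show -((k + 4 : ℕ) : ℝ) / 2 = -((k + 2 : ℕ) : ℝ) / 2 - 1 by push_cast; ring,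
      Real.rpow_sub_one h0, mul_div_cancel₀ _ h0]
  rw [e1, show -((k + 2 : ℕ) : ℝ) / 2 - 1 = -((k + 4 : ℕ) : ℝ) / 2 by push_cast; ring]
  simp only [show k + 2 - 1 = k + 1 from rfl]
  push_cast
  ring

theorem tendsto_radial (k : ℕ) :
    Tendsto (fun r : ℝ => r ^ (k + 2) * (r ^ 2 + 1 ^ 2) ^ (-((k + 2 : ℕ) : ℝ) / 2)) atTop
      (𝓝 1) := by
  have h1 : Tendsto (fun r : ℝ => (1 + (r⁻¹) ^ 2) ^ (-((k + 2 : ℕ) : ℝ) / 2)) atTop (𝓝 1) := by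
    have h2 : Tendsto (fun r : ℝ => 1 + (r⁻¹) ^ 2) atTop (𝓝 1) := by
      simpa using (tendsto_inv_atTop_zero.pow 2).const_add (1 : ℝ)
    simpa using h2.rpow_const (p := -((k + 2 : ℕ) : ℝ) / 2) (Or.inl one_ne_zero)
  refine h1.congr' ?_
  filter_upwards [eventually_gt_atTop 0] with r hr
  rw [show r ^ 2 + 1 ^ 2 = r ^ 2 * (1 + (r⁻¹) ^ 2) by field_simp,
    Real.mul_rpow (by positivity) (by positivity), sq_rpow_neg_half _ hr.le, ← mul_assoc,
    mul_inv_cancel₀ (by positivity), one_mul]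

theorem integral_bump (k : ℕ) : ∫ z, bump k z = 1 := by
  have h1 := integral_fun_norm_addHaar (volume : Measure (Space k))
    (fun r : ℝ => ((k : ℝ) + 2) * (r ^ 2 + 1 ^ 2) ^ (-((k + 4 : ℕ) : ℝ) / 2))
  have h2 := integral_Ioi_of_hasDerivAt_of_nonneg' (a := 0) (l := 1)
    (fun r _ => hasDerivAt_radial k r)
    (fun r hr => by have : (0 : ℝ) < r := hr; positivity) (tendsto_radial k)
  have h3 : Module.finrank ℝ (Space k) - 1 = k + 1 := by simp
  simp only [h3, smul_eq_mul, h2] at h1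
  simp only [bump, invPow, integral_const_mul]
  rw [integral_const_mul] at h1
  rw [h1, sphereArea, Measure.toSphere_real_apply_univ]
  have := sphereArea_pos k
  rw [sphereArea, Measure.toSphere_real_apply_univ] at this
  rw [nsmul_eq_mul]
  simp only [ne_eq, Nat.add_eq_zero_iff, OfNat.ofNat_ne_zero, and_false, not_false_eq_true,
    zero_pow, zero_mul, sub_zero, mul_one]
  exact inv_mul_cancel₀ this.ne'

/-- The decay needed for an approximate identity acting on functions that are merely integrable and
continuous at the origin. -/
theorem tendsto_bump (k : ℕ) :
    Tendsto (fun z => ‖z‖ ^ Module.finrank ℝ (Space k) * bump k z)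
      (Bornology.cobounded (Space k)) (𝓝 0) := by
  have h1 : Tendsto (fun z : Space k => ‖z‖) (Bornology.cobounded (Space k)) atTop :=
    tendsto_norm_cobounded_atTop
  have h2 : Tendsto (fun r : ℝ => (sphereArea k)⁻¹ * (((k : ℝ) + 2) * ((r ^ (k + 2) *
      (r ^ 2 + 1 ^ 2) ^ (-((k + 2 : ℕ) : ℝ) / 2)) * (r ^ 2 + 1 ^ 2)⁻¹))) atTop (𝓝 0) := by
    have h3 : Tendsto (fun r : ℝ => (r ^ 2 + 1 ^ 2)⁻¹) atTop (𝓝 0) :=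
      tendsto_inv_atTop_zero.comp
        (tendsto_atTop_add_const_right _ _ (tendsto_pow_atTop two_ne_zero))
    simpa using (((tendsto_radial k).mul h3).const_mul ((k : ℝ) + 2)).const_mul (sphereArea k)⁻¹
  refine (h2.comp h1).congr fun z => ?_
  have h0 : ‖z‖ ^ 2 + 1 ^ 2 ≠ 0 := by positivity
  simp only [Function.comp_apply, bump, invPow, finrank_euclideanSpace, Fintype.card_fin]
  rw [show -((k + 4 : ℕ) : ℝ) / 2 = -((k + 2 : ℕ) : ℝ) / 2 - 1 by push_cast; ring,
      Real.rpow_sub_one h0]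
  ring

/-- The Cauchy kernel is a fundamental solution of the Dirac operator. -/
theorem sum_e_mul_integral_cauchy {k : ℕ} {h : Space k → Cl k} (hh : ContDiff ℝ 1 h)
    (hc : HasCompactSupport h) :
    ∑ j, e j * ∫ z, cauchy 0 z * fderiv ℝ h z (EuclideanSpace.single j 1) =
      -(sphereArea k • h 0) := by
  refine tendsto_nhds_unique (tendsto_sum_e_mul_integral locallyIntegrable_cauchy
    (fun c hc => (contDiff_cauchy (by positivity)).continuous) (fun z hz => tendsto_cauchy hz)
    (fun ε z hz => norm_cauchy_le ε hz) hh hc) ?_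
  have h1 := (tendsto_integral_comp_smul_smul_of_integrable (μ := (volume : Measure (Space k)))
    (φ := bump k) (g := h)
    (fun z => by
      have := sphereArea_pos k
      have := invPow_nonneg (k + 4) 1 z
      unfold bump
      positivity) (integral_bump k) (tendsto_bump k) (hh.continuous.integrable_of_hasCompactSupport hc)
      hh.continuous.continuousAt).const_smul (sphereArea k)
  refine h1.neg.congr' ?_
  -- For ε = 1/c, the Dirac derivative of the Cauchy kernel is ω_n cⁿ `bump k (c • z)`: the factor
  -- ε² = c⁻² meets c^(k+4) from the scaling.
  filter_upwards [eventually_gt_atTop 0] with c hc0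
  rw [sum_e_mul_integral_mul_fderiv (contDiff_cauchy (by positivity)) hh hc, ← integral_smul]
  congr 2
  ext1 z
  rw [diracSum_fderiv_cauchy (pos_of_inv_pos hc0 z), smul_mul_assoc, one_mul, smul_smul,
    invPow_smul _ hc0, bump]
  congr 1
  have := (sphereArea_pos k).ne'
  simp only [finrank_euclideanSpace, Fintype.card_fin]
  field_simp
  ring

/-! ### Differentiation of integrals depending on a parameter. -/

section Singular

variable {k : ℕ} {κ : Space k → Cl k} {V : Set (Space k)} {H : Space k × Space k → Cl k}
  {C : Set (Space k)} {y₀ : Space k}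

theorem fderiv_eq_zero_of_notMem (hV : IsOpen V) (hC : IsCompact C)
    (hH0 : ∀ x ∉ C, ∀ y ∈ V, H (x, y) = 0) {x y : Space k} (hx : x ∉ C) (hy : y ∈ V) :
    fderiv ℝ H (x, y) = 0 := by
  have h : H =ᶠ[𝓝 (x, y)] fun _ => 0 := by
    filter_upwards [(hC.isClosed.isOpen_compl.prod hV).mem_nhds ⟨hx, hy⟩] with p hp
    exact hH0 p.1 hp.1 p.2 hp.2
  rw [h.fderiv_eq, fderiv_fun_const]; rfl

theorem continuous_fderiv_translate (hV : IsOpen V) (hH : ContDiffOn ℝ 1 H (Set.univ ×ˢ V))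
    (hy₀ : y₀ ∈ V) : Continuous fun z => fderiv ℝ H (z + y₀, y₀) := by
  rw [← continuousOn_univ]
  exact (hH.continuousOn_fderiv_of_isOpen (isOpen_univ.prod hV) le_rfl).comp
    (by fun_prop) fun z _ => ⟨trivial, hy₀⟩

theorem contDiff_translate (hH : ContDiffOn ℝ 1 H (Set.univ ×ˢ V))
    (hy₀ : y₀ ∈ V) : ContDiff ℝ 1 fun z => H (z + y₀, y₀) := by
  rw [← contDiffOn_univ]
  exact hH.comp (by fun_prop) fun z _ => ⟨trivial, hy₀⟩

theorem isCompact_translate (hC : IsCompact C) (y₀ : Space k) :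
    IsCompact ((fun x => x - y₀) '' C) := hC.image (by fun_prop)

theorem hasCompactSupport_translate (hC : IsCompact C) (hH0 : ∀ x ∉ C, ∀ y ∈ V, H (x, y) = 0)
    (hy₀ : y₀ ∈ V) : HasCompactSupport fun z => H (z + y₀, y₀) := by
  refine HasCompactSupport.intro (isCompact_translate hC y₀) fun z hz => hH0 _ (fun h => hz ?_) _ hy₀
  exact ⟨_, h, by simp⟩

theorem hasCompactSupport_fderiv_translate (hV : IsOpen V) (hC : IsCompact C)
    (hH0 : ∀ x ∉ C, ∀ y ∈ V, H (x, y) = 0) (hy₀ : y₀ ∈ V) :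
    HasCompactSupport fun z => fderiv ℝ H (z + y₀, y₀) := by
  refine HasCompactSupport.intro (isCompact_translate hC y₀) fun z hz =>
    fderiv_eq_zero_of_notMem hV hC hH0 (fun h => hz ?_) hy₀
  exact ⟨_, h, by simp⟩

theorem differentiableAt_of_contDiffOn_prod (hV : IsOpen V)
    (hH : ContDiffOn ℝ 1 H (Set.univ ×ˢ V)) {x y : Space k} (hy : y ∈ V) :
    DifferentiableAt ℝ H (x, y) :=
  (hH.differentiableOn one_ne_zero).differentiableAt
    ((isOpen_univ.prod hV).mem_nhds ⟨trivial, hy⟩)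

/-- After the substitution x = z + y the kernel is independent of y, so it need only be locally
integrable. The parameter enters both slots of `H`, hence the diagonal direction (v, v). -/
theorem hasFDerivAt_integral_translate (hκ : LocallyIntegrable κ) (hV : IsOpen V)
    (hH : ContDiffOn ℝ 1 H (Set.univ ×ˢ V)) (hC : IsCompact C)
    (hH0 : ∀ x ∉ C, ∀ y ∈ V, H (x, y) = 0) (hy₀ : y₀ ∈ V) :
    ∃ T : Space k →L[ℝ] Cl k, HasFDerivAt (fun y => ∫ z, κ z * H (z + y, y)) T y₀ ∧
      ∀ v, T v = ∫ z, κ z * fderiv ℝ H (z + y₀, y₀) (v, v) := by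
  obtain ⟨δ, hδ, hδV⟩ := Metric.nhds_basis_closedBall.mem_iff.mp (hV.mem_nhds hy₀)
  set B := Metric.closedBall y₀ δ
  have hB : IsCompact B := isCompact_closedBall _ _
  have hfc : ContinuousOn (fderiv ℝ H) (Set.univ ×ˢ V) :=
    hH.continuousOn_fderiv_of_isOpen (isOpen_univ.prod hV) le_rfl
  obtain ⟨M, hM⟩ := (hC.prod hB).exists_bound_of_continuousOn
    (hfc.mono (Set.prod_mono (Set.subset_univ _) hδV))
  -- The difference set C - B contains every z with z + y ∈ C for some y ∈ B, so one compact set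
  -- carries a majorant uniform in y.
  set D := (fun p : Space k × Space k => p.1 - p.2) '' (C ×ˢ B)
  have hD : IsCompact D := (hC.prod hB).image (by fun_prop)
  let J : Space k →L[ℝ] Space k × Space k :=
    (ContinuousLinearMap.id ℝ (Space k)).prod (ContinuousLinearMap.id ℝ (Space k))
  let F' : Space k → Space k → (Space k →L[ℝ] Cl k) := fun y z =>
    (mulL k (κ z)) ∘L (fderiv ℝ H (z + y, y) ∘L J)
  have hmeas : AEStronglyMeasurable (F' y₀) := by
    refine (ContinuousLinearMap.compL ℝ (Space k) (Cl k) (Cl k)).aestronglyMeasurable_comp₂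
      ((mulL k).continuous.comp_aestronglyMeasurable hκ.aestronglyMeasurable) ?_
    exact ((continuous_fderiv_translate hV hH hy₀).clm_comp continuous_const).aestronglyMeasurable
  have hbound : ∀ z, ∀ y ∈ Metric.ball y₀ δ,
      ‖F' y z‖ ≤ D.indicator (fun z => ‖mulL k‖ * ‖κ z‖ * (M * ‖J‖)) z := by
    intro z y hy
    have hyB : y ∈ B := Metric.ball_subset_closedBall hy
    by_cases hzC : z + y ∈ C
    · have hz : z ∈ D := ⟨(z + y, y), ⟨hzC, hyB⟩, by simp⟩
      rw [Set.indicator_of_mem hz]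
      have h1 := hM _ (show (z + y, y) ∈ C ×ˢ B from ⟨hzC, hyB⟩)
      calc ‖F' y z‖ ≤ ‖mulL k (κ z)‖ * ‖fderiv ℝ H (z + y, y) ∘L J‖ :=
            ContinuousLinearMap.opNorm_comp_le _ _
        _ ≤ (‖mulL k‖ * ‖κ z‖) * (‖fderiv ℝ H (z + y, y)‖ * ‖J‖) :=
            mul_le_mul ((mulL k).le_opNorm _) (ContinuousLinearMap.opNorm_comp_le _ _)
              (norm_nonneg _) (by positivity)
        _ ≤ _ := by gcongr
    · have h0 : F' y z = 0 := by
        simp only [F', fderiv_eq_zero_of_notMem hV hC hH0 hzC (hδV hyB)]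
        simp
      rw [h0, norm_zero]
      refine Set.indicator_nonneg (fun z hz => ?_) _
      obtain ⟨p, hp, -⟩ := hz
      have := (norm_nonneg _).trans (hM p hp)
      positivity
  have hbint : Integrable (D.indicator (fun z => ‖mulL k‖ * ‖κ z‖ * (M * ‖J‖))) := by
    rw [integrable_indicator_iff hD.isClosed.measurableSet]
    exact ((hκ.integrableOn_isCompact hD).norm.const_mul _).mul_const _
  have hT := hasFDerivAt_integral_of_dominated_of_fderiv_le (μ := volume)
    (F := fun y z => κ z * H (z + y, y)) (F' := F') (x₀ := y₀) (Metric.ball_mem_nhds y₀ hδ)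
    (by
      filter_upwards [hV.mem_nhds hy₀] with y hy
      exact aestronglyMeasurable_cl_mul hκ.aestronglyMeasurable
        (contDiff_translate hH hy).continuous.aestronglyMeasurable)
    (integrable_cl_mul hκ (contDiff_translate hH hy₀).continuous
      (hasCompactSupport_translate hC hH0 hy₀))
    hmeas (Eventually.of_forall hbound) hbint
    (Eventually.of_forall fun z y hy => by
      have h1 := (differentiableAt_of_contDiffOn_prod hV hH (x := z + y)
        (hδV (Metric.ball_subset_closedBall hy))).hasFDerivAt
      have h2 : HasFDerivAt (fun y => (z + y, y)) J y :=
        ((hasFDerivAt_id y).const_add z).prodMk (hasFDerivAt_id y)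
      exact (mulL k (κ z)).hasFDerivAt.comp y (HasFDerivAt.comp (f := fun y => (z + y, y)) y h1 h2))
  refine ⟨_, hT, fun v => ?_⟩
  rw [ContinuousLinearMap.integral_apply]
  · rfl
  · exact hbint.mono' hmeas (Eventually.of_forall fun z => hbound z y₀ (Metric.mem_ball_self hδ))

/-- Differentiation of a singular integral of convolution type with a `C¹` compactly supported
density that depends on the parameter. -/
theorem hasFDerivAt_singular_integral (hκ : LocallyIntegrable κ) (hV : IsOpen V)
    (hH : ContDiffOn ℝ 1 H (Set.univ ×ˢ V)) (hC : IsCompact C)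
    (hH0 : ∀ x ∉ C, ∀ y ∈ V, H (x, y) = 0) (hy₀ : y₀ ∈ V) :
    (∀ v, Integrable fun x => κ (x - y₀) * fderiv ℝ (fun y => H (x, y)) y₀ v) ∧
    ∃ T : Space k →L[ℝ] Cl k, HasFDerivAt (fun y => ∫ x, κ (x - y) * H (x, y)) T y₀ ∧
      ∀ v, T v = (∫ z, κ z * fderiv ℝ (fun z => H (z + y₀, y₀)) z v) +
        ∫ x, κ (x - y₀) * fderiv ℝ (fun y => H (x, y)) y₀ v := by
  have hx : ∀ x v, fderiv ℝ (fun y => H (x, y)) y₀ v = fderiv ℝ H (x, y₀) (0, v) := by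
    intro x v
    have h1 := (differentiableAt_of_contDiffOn_prod hV hH (x := x) hy₀).hasFDerivAt
    have h3 : HasFDerivAt (fun y => H (x, y)) _ y₀ := h1.comp y₀ (hasFDerivAt_prodMk_right x y₀)
    rw [h3.fderiv]
    simp
  have hz : ∀ z v, fderiv ℝ (fun z => H (z + y₀, y₀)) z v = fderiv ℝ H (z + y₀, y₀) (v, 0) := by
    intro z v
    have h1 := (differentiableAt_of_contDiffOn_prod hV hH (x := z + y₀) hy₀).hasFDerivAt
    have h2 : HasFDerivAt (fun z => (z + y₀, y₀)) (ContinuousLinearMap.inl ℝ (Space k) (Space k)) z :=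
      ((hasFDerivAt_id z).add_const y₀).prodMk (hasFDerivAt_const y₀ z)
    have h3 : HasFDerivAt (fun z => H (z + y₀, y₀)) _ z :=
      HasFDerivAt.comp (f := fun z => (z + y₀, y₀)) z h1 h2
    rw [h3.fderiv]
    simp
  have hint : ∀ w, Integrable fun z => κ z * fderiv ℝ H (z + y₀, y₀) w := fun w =>
    integrable_cl_mul hκ ((continuous_fderiv_translate hV hH hy₀).clm_apply continuous_const)
      ((hasCompactSupport_fderiv_translate hV hC hH0 hy₀).mono fun z hz h0 => hz (by
        simp only at h0; simp [h0]))
  have hshift : ∀ (f : Space k → Cl k), (fun z => κ z * f (z + y₀)) =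
      fun z => (fun x => κ (x - y₀) * f x) (z + y₀) := by
    intro f; ext1 z; simp
  obtain ⟨T, hT, hTv⟩ := hasFDerivAt_integral_translate hκ hV hH hC hH0 hy₀
  simp only [hx, hz]
  refine ⟨fun v => ?_, T, ?_, fun v => ?_⟩
  · have h := hint (0, v)
    rw [hshift fun x => fderiv ℝ H (x, y₀) (0, v)] at h
    simpa using h.comp_sub_right y₀
  · refine hT.congr_of_eventuallyEq (Eventually.of_forall fun y => ?_)
    beta_reduce
    rw [← integral_add_right_eq_self (fun x => κ (x - y) * H (x, y)) y]
    simp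
  -- Splitting (v, v) = (v, 0) + (0, v): the first part is a z-derivative, ready for integration by
  -- parts; the second is shifted back to the variable x.
  · rw [hTv, ← integral_add_right_eq_self (fun x => κ (x - y₀) * _) y₀,
      ← integral_add (hint _) (by simpa using hint (0, v))]
    congr 1
    ext1 z
    rw [add_sub_cancel_right, ← mul_add, ← map_add]
    simp

end Singular

/-- Differentiation under the integral sign of a `C¹` kernel. -/
theorem hasFDerivAt_regular_integral {k : ℕ} {f : Space k × Space k → Cl k}
    {U : Set (Space k × Space k)} (hU : IsOpen U) (hf : ContDiffOn ℝ 1 f U) {A C : Set (Space k)}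
    (hA : MeasurableSet A) (hAC : A ⊆ C) (hC : IsCompact C) {y₀ : Space k}
    (hCU : ∀ x ∈ C, (x, y₀) ∈ U) {l : Space k → Cl k} (hl : IntegrableOn l A) :
    (∀ v, IntegrableOn (fun x => fderiv ℝ (fun y => f (x, y)) y₀ v * l x) A) ∧
    ∃ T : Space k →L[ℝ] Cl k, HasFDerivAt (fun y => ∫ x in A, f (x, y) * l x) T y₀ ∧
      ∀ v, T v = ∫ x in A, fderiv ℝ (fun y => f (x, y)) y₀ v * l x := by
  -- The tube lemma thickens C × {y₀} to C times a closed ball inside `U`, a compact set on which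
  -- the kernel and its derivative are bounded.
  obtain ⟨W, V, hW, hV, hCW, hyV, hWV⟩ := generalized_tube_lemma hC (isCompact_singleton (x := y₀)) hU
    (by rintro ⟨x, y⟩ ⟨hx, rfl⟩; exact hCU x hx)
  obtain ⟨δ, hδ, hδV⟩ := Metric.nhds_basis_closedBall.mem_iff.mp (hV.mem_nhds (hyV rfl))
  have hsub : C ×ˢ Metric.closedBall y₀ δ ⊆ U := (Set.prod_mono hCW hδV).trans hWV
  have hfc : ContinuousOn (fderiv ℝ f) U := hf.continuousOn_fderiv_of_isOpen hU le_rfl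
  obtain ⟨M, hM⟩ := (hC.prod (isCompact_closedBall y₀ δ)).exists_bound_of_continuousOn
    (hfc.mono hsub)
  obtain ⟨M', hM'⟩ := (hC.prod (isCompact_closedBall y₀ δ)).exists_bound_of_continuousOn
    (hf.continuousOn.mono hsub)
  let J := ContinuousLinearMap.inr ℝ (Space k) (Space k)
  let F' : Space k → Space k → (Space k →L[ℝ] Cl k) := fun y x =>
    ((mulL k).flip (l x)) ∘L (fderiv ℝ f (x, y) ∘L J)
  have hcont : ∀ y ∈ Metric.closedBall y₀ δ, ContinuousOn (fun x => f (x, y)) A := fun y hy =>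
    hf.continuousOn.comp (by fun_prop) fun x hx => hsub ⟨hAC hx, hy⟩
  have hy₀ : y₀ ∈ Metric.closedBall y₀ δ := Metric.mem_closedBall_self hδ.le
  have hder : ∀ x ∈ A, ∀ y ∈ Metric.ball y₀ δ, HasFDerivAt (fun y => f (x, y))
      (fderiv ℝ f (x, y) ∘L J) y := by
    intro x hx y hy
    have h1 := ((hf.differentiableOn one_ne_zero).differentiableAt (hU.mem_nhds (hsub
      (show (x, y) ∈ _ from ⟨hAC hx, Metric.ball_subset_closedBall hy⟩)))).hasFDerivAt
    exact h1.comp y (hasFDerivAt_prodMk_right x y)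
  have hmeas : AEStronglyMeasurable (F' y₀) (volume.restrict A) := by
    refine (ContinuousLinearMap.compL ℝ (Space k) (Cl k) (Cl k)).aestronglyMeasurable_comp₂
      ((mulL k).flip.continuous.comp_aestronglyMeasurable hl.1) ?_
    refine ContinuousOn.aestronglyMeasurable ?_ hA
    exact (hfc.comp (f := fun x => (x, y₀)) (by fun_prop)
      fun x hx => hsub ⟨hAC hx, hy₀⟩).clm_comp continuousOn_const
  have hbound : ∀ᵐ x ∂(volume.restrict A), ∀ y ∈ Metric.ball y₀ δ,
      ‖F' y x‖ ≤ ‖(mulL k).flip‖ * ‖l x‖ * (M * ‖J‖) := by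
    filter_upwards [ae_restrict_mem hA] with x hx y hy
    have h1 := hM (x, y) ⟨hAC hx, Metric.ball_subset_closedBall hy⟩
    calc ‖F' y x‖ ≤ ‖(mulL k).flip (l x)‖ * ‖fderiv ℝ f (x, y) ∘L J‖ :=
          ContinuousLinearMap.opNorm_comp_le _ _
      _ ≤ (‖(mulL k).flip‖ * ‖l x‖) * (‖fderiv ℝ f (x, y)‖ * ‖J‖) :=
          mul_le_mul ((mulL k).flip.le_opNorm _) (ContinuousLinearMap.opNorm_comp_le _ _)
            (norm_nonneg _) (by positivity)
      _ ≤ _ := by gcongr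
  have hbint : Integrable (fun x => ‖(mulL k).flip‖ * ‖l x‖ * (M * ‖J‖)) (volume.restrict A) :=
    (hl.norm.const_mul _).mul_const _
  have hmeasF : ∀ y ∈ Metric.closedBall y₀ δ,
      AEStronglyMeasurable (fun x => f (x, y) * l x) (volume.restrict A) := fun y hy =>
    aestronglyMeasurable_cl_mul ((hcont y hy).aestronglyMeasurable hA) hl.1
  have hT := hasFDerivAt_integral_of_dominated_of_fderiv_le (μ := volume.restrict A)
    (F := fun y x => f (x, y) * l x) (F' := F') (x₀ := y₀) (Metric.ball_mem_nhds y₀ hδ)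
    (by
      filter_upwards [Metric.closedBall_mem_nhds y₀ hδ] with y hy using hmeasF y hy)
    (by
      refine Integrable.mono' (g := fun x => ‖mulL k‖ * M' * ‖l x‖) (hl.norm.const_mul _)
        (hmeasF y₀ hy₀) ?_
      filter_upwards [ae_restrict_mem hA] with x hx
      refine (norm_cl_mul_le _ _).trans ?_
      have := hM' (x, y₀) ⟨hAC hx, hy₀⟩
      gcongr)
    hmeas hbound hbint
    (by
      filter_upwards [ae_restrict_mem hA] with x hx y hy
      exact ((mulL k).flip (l x)).hasFDerivAt.comp y (hder x hx y hy))
  have hFint : Integrable (F' y₀) (volume.restrict A) := by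
    refine hbint.mono' hmeas ?_
    filter_upwards [hbound] with x hx using hx y₀ (Metric.mem_ball_self hδ)
  have hae : ∀ v, (fun x => F' y₀ x v) =ᵐ[volume.restrict A]
      fun x => fderiv ℝ (fun y => f (x, y)) y₀ v * l x := by
    intro v
    filter_upwards [ae_restrict_mem hA] with x hx
    rw [(hder x hx y₀ (Metric.mem_ball_self hδ)).fderiv]
    rfl
  refine ⟨fun v => (hFint.apply_continuousLinearMap v).congr (hae v), _, hT, fun v => ?_⟩
  rw [ContinuousLinearMap.integral_apply hFint, integral_congr_ae (hae v)]

/-! ### The Dirac operator of the weighted kernels in the variable y. -/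

theorem dirac_smul {k : ℕ} {c : Space k → ℝ} {f : Space k → Cl k}
    {w y : Space k} (hc : HasFDerivAt c (innerSL ℝ w) y) (hf : DifferentiableAt ℝ f y) :
    dirac (fun y => c y • f y) y = vec w * f y + c y • dirac f y := by
  have h : HasFDerivAt (fun y => c y • f y) _ y := hc.smul hf.hasFDerivAt
  rw [dirac_eq, h.fderiv, ← diracSumL_apply, map_add, map_smul,
    diracSumL_apply, diracSumL_apply, diracSum_smulRight, ← dirac_eq, add_comm]

theorem dirac_const {k : ℕ} (a : Cl k) (y : Space k) : dirac (fun _ => a) y = 0 := by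
  simp [dirac]

theorem dirac_mul_const {k : ℕ} {f : Space k → Cl k} {y : Space k}
    (hf : DifferentiableAt ℝ f y) (a : Cl k) :
    dirac (fun y => f y * a) y = dirac f y * a := by
  have h : HasFDerivAt (fun y => f y * a) ((mulL k).flip a ∘L fderiv ℝ f y) y :=
    ((mulL k).flip a).hasFDerivAt.comp y hf.hasFDerivAt
  rw [dirac_eq, h.fderiv, diracSum_mulRight, ← dirac_eq]

theorem hasFDerivAt_invPow_sub {k : ℕ} (m : ℕ) {x y : Space k} (h : x - y ≠ 0) :
    HasFDerivAt (fun y => invPow m 0 (x - y))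
      (innerSL ℝ ((m * invPow (m + 2) 0 (x - y)) • (x - y))) y := by
  have h0 : 0 < ‖x - y‖ ^ 2 + (0 : ℝ) ^ 2 := by
    have := norm_pos_iff.mpr h
    positivity
  have h1 := (hasFDerivAt_invPow m h0).comp y ((hasFDerivAt_id y).const_sub x)
  refine h1.congr_fderiv ?_
  ext v
  simp

theorem invPow_zero_add_two {k : ℕ} (m : ℕ) (z : Space k) :
    invPow (m + 2) 0 z = (‖z‖ ^ 2)⁻¹ * invPow m 0 z := by
  rw [invPow_zero, invPow_zero, pow_add, mul_inv, mul_comm]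

theorem vecInv_eq {k : ℕ} (v : Space k) : vecInv v = (-invPow 2 0 v) • vec v := by
  rw [vecInv, invPow_zero]

theorem hasFDerivAt_vec_sub {k : ℕ} (x y : Space k) :
    HasFDerivAt (fun y => vec (x - y)) (-vecL k) y := by
  have h := (vecL k).hasFDerivAt.comp y ((hasFDerivAt_id y).const_sub x)
  refine h.congr_fderiv ?_
  ext v
  simp

theorem dirac_vec_sub {k : ℕ} (x y : Space k) :
    dirac (fun y => vec (x - y)) y = ((k : ℝ) + 2) • (1 : Cl k) := by
  rw [dirac_eq, (hasFDerivAt_vec_sub x y).fderiv, ← diracSumL_apply, map_neg, diracSumL_apply,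
    diracSum_vecL, neg_smul, neg_neg]

/-- Two exponents matter: m = k + 2 is the Cauchy kernel, where the factor vanishes, and m = 2 is
the Clifford inverse, where it gives k times the squared inverse. -/
theorem dirac_invPow_smul_vec {k : ℕ} (m : ℕ) {x y : Space k} (h : x - y ≠ 0) :
    dirac (fun y => (-invPow m 0 (x - y)) • vec (x - y)) y =
      (((m : ℝ) - ((k : ℝ) + 2)) * invPow m 0 (x - y)) • (1 : Cl k) := by
  have h1 : HasFDerivAt (fun y => -invPow m 0 (x - y))
      (innerSL ℝ (-((m * invPow (m + 2) 0 (x - y)) • (x - y)))) y := by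
    rw [map_neg]; exact (hasFDerivAt_invPow_sub m h).neg
  rw [dirac_smul h1 (hasFDerivAt_vec_sub x y).differentiableAt, dirac_vec_sub,
    ← vecL_apply (-_), map_neg, map_smul, vecL_apply, neg_mul, smul_mul_assoc, vec_mul_self,
    invPow_zero_add_two m, smul_smul, smul_smul, ← neg_smul, ← add_smul]
  congr 1
  have := norm_ne_zero_iff.mpr h
  field_simp
  ring

theorem differentiableAt_invPow_smul_vec {k : ℕ} (m : ℕ) {x y : Space k} (h : x - y ≠ 0) :
    DifferentiableAt ℝ (fun y => (-invPow m 0 (x - y)) • vec (x - y)) y :=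
  (hasFDerivAt_invPow_sub m h).neg.differentiableAt.smul (hasFDerivAt_vec_sub x y).differentiableAt

theorem dirac_cauchy_sub {k : ℕ} {x y : Space k} (h : x - y ≠ 0) :
    dirac (fun y => cauchy 0 (x - y)) y = 0 := by
  simp only [cauchy]
  rw [dirac_invPow_smul_vec _ h]
  push_cast
  rw [sub_self, zero_mul, zero_smul]

theorem dirac_vecInv_sub {k : ℕ} {x y : Space k} (h : x - y ≠ 0) :
    dirac (fun y => vecInv (x - y)) y = (k : ℝ) • (vecInv (x - y) * vecInv (x - y)) := by
  simp only [vecInv_mul_self, smul_smul]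
  simp only [vecInv_eq]
  rw [dirac_invPow_smul_vec _ h, invPow_zero]
  congr 1
  push_cast
  ring

theorem differentiableAt_vecInv_sub {k : ℕ} {x y : Space k} (h : x - y ≠ 0) :
    DifferentiableAt ℝ (fun y => vecInv (x - y)) y := by
  simp only [vecInv_eq]
  exact differentiableAt_invPow_smul_vec _ h

/-- The weight `(2 y_n)^{n-2} / ‖x̂ - y‖^{n-2}`. -/
def weight {k : ℕ} (x y : Space k) : ℝ := (2 * y (lastIdx k)) ^ k * invPow k 0 (reflLast k x - y)

/-- The gradient of `weight` in the second variable. -/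
def weightGrad {k : ℕ} (x y : Space k) : Space k :=
  (k * weight x y) • ((y (lastIdx k))⁻¹ • EuclideanSpace.single (lastIdx k) (1 : ℝ) +
    (‖reflLast k x - y‖ ^ 2)⁻¹ • (reflLast k x - y))

/-- The logarithmic gradient of the weight is k(e_n/y_n + v/‖v‖²) with v = x̂ - y, and v/‖v‖² is
minus the Clifford inverse of v. -/
theorem vec_weightGrad {k : ℕ} (x y : Space k) : vec (weightGrad x y) =
    (k * weight x y) • ((y (lastIdx k))⁻¹ • eLast k - vecInv (reflLast k x - y)) := by
  rw [weightGrad, ← vecL_apply, map_smul, map_add, map_smul, map_smul, vecInv, neg_smul,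
    sub_neg_eq_add]
  rfl

theorem hasFDerivAt_weight {k : ℕ} {x y : Space k} (hy : y (lastIdx k) ≠ 0)
    (hv : reflLast k x - y ≠ 0) : HasFDerivAt (weight x) (innerSL ℝ (weightGrad x y)) y := by
  have h1 : HasFDerivAt (fun y : Space k => (2 * y (lastIdx k)) ^ k)
      (innerSL ℝ ((k * (2 * y (lastIdx k)) ^ k * (y (lastIdx k))⁻¹) •
        EuclideanSpace.single (lastIdx k) (1 : ℝ))) y := by
    have h := (((EuclideanSpace.proj (lastIdx k) : Space k →L[ℝ] ℝ).hasFDerivAt (x := y)).const_mul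
      2).pow k
    refine h.congr_fderiv ?_
    ext v
    -- The derivative of a k-th power involves the truncated exponent k - 1, so k = 0 is treated
    -- apart.
    rcases k with _ | k
    · simp
    · simp [pow_succ, EuclideanSpace.inner_single_left]
      field_simp
  have h2 := h1.mul (hasFDerivAt_invPow_sub k hv)
  refine h2.congr_fderiv ?_
  rw [weightGrad, weight, invPow_zero_add_two k]
  simp only [← map_smul, ← map_add]
  congr 1
  module

theorem cauchy_zero_eq_smul_vecInv {k : ℕ} (z : Space k) : cauchy 0 z = invPow k 0 z • vecInv z := by
  rw [cauchy_zero, invPow_zero]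

/-- The kernel `(2 y_n)^{n-2} E(x, y)`. -/
def weightedE {k : ℕ} (p : Space k × Space k) : Cl k := weight p.1 p.2 • cauchy 0 (p.1 - p.2)

/-- The kernel `(2 y_n)^{n-2} F(x, y)`. -/
def weightedF {k : ℕ} (p : Space k × Space k) : Cl k :=
  weight p.1 p.2 • (newton 0 (p.1 - p.2) * vecInv (reflLast k p.1 - p.2))

theorem weightedE_eq {k : ℕ} (x y : Space k) :
    weightedE (x, y) = (2 * y (lastIdx k)) ^ k • kernelE x y := by
  simp only [weightedE, weight, kernelE, cauchy_zero, invPow_zero, smul_smul, norm_sub_reflLast,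
    mul_inv]
  congr 1
  ring

theorem weightedF_eq {k : ℕ} (x y : Space k) :
    weightedF (x, y) = (2 * y (lastIdx k)) ^ k • kernelF x y := by
  simp only [weightedF, weight, kernelF, newton, invPow_zero, smul_smul, mul_inv, smul_mul_assoc,
    one_mul]
  congr 1
  ring

/-- The value of the Dirac operator, in the second variable, on the kernel applied to `a`. -/
def kernelDirac {k : ℕ} (x y : Space k) (a : Cl k) : Cl k :=
  vec (weightGrad x y) * (cauchy 0 (x - y) * a -
      newton 0 (x - y) * (vecInv (reflLast k x - y) * hat a)) +
    (k * weight x y) • (cauchy 0 (x - y) * (vecInv (reflLast k x - y) * hat a) -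
      newton 0 (x - y) * (vecInv (reflLast k x - y) * vecInv (reflLast k x - y) * hat a))

/-- `Q'` as a continuous linear map. -/
def projQL (k : ℕ) : Cl k →L[ℝ] Cl k :=
  (-(1 / 2) : ℝ) • (mulL k (eLast k) ∘L (ContinuousLinearMap.id ℝ (Cl k) - hatL k))

@[simp] theorem projQL_apply {k : ℕ} (a : Cl k) : projQL k a = projQ' a := by
  simp [projQL, projQ'_eq, mul_sub]

/-- All terms share the scalar k w ‖x - y‖^(-k), with w the weight; what remains is
`kernel_identity`. -/
theorem kernelDirac_add_projQ' {k : ℕ} {x y : Space k} (hy : y (lastIdx k) ≠ 0) (hu : x - y ≠ 0)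
    (hv : reflLast k x - y ≠ 0) (a : Cl k) :
    kernelDirac x y a + ((k : ℝ) / y (lastIdx k)) •
      projQ' (weightedE (x, y) * a - weightedF (x, y) * hat a) = 0 := by
  have h : kernelDirac x y a + ((k : ℝ) / y (lastIdx k)) •
      projQ' (weightedE (x, y) * a - weightedF (x, y) * hat a) =
      (k * weight x y * invPow k 0 (x - y)) • (0 : Cl k) := by
    rw [← kernel_identity hy hu hv a, kernelDirac, weightedE, weightedF, newton,
      cauchy_zero_eq_smul_vecInv, vec_weightGrad]
    simp only [← projQL_apply, smul_mul_assoc, one_mul, map_sub, map_smul, mul_sub, sub_mul,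
      mul_smul_comm, mul_assoc, smul_sub, smul_add, smul_smul]
    rw [div_eq_mul_inv]
    module
  rw [h, smul_zero]

theorem dirac_weightedE {k : ℕ} {x y : Space k} (hy : y (lastIdx k) ≠ 0) (hu : x - y ≠ 0)
    (hv : reflLast k x - y ≠ 0) :
    dirac (fun y => weightedE (x, y)) y = vec (weightGrad x y) * cauchy 0 (x - y) := by
  simp only [weightedE]
  rw [dirac_smul (c := weight x) (hasFDerivAt_weight hy hv), dirac_cauchy_sub hu,
    smul_zero, add_zero]
  simp only [cauchy]
  exact differentiableAt_invPow_smul_vec _ hu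

theorem dirac_weight_vecInv {k : ℕ} {x y : Space k} (hy : y (lastIdx k) ≠ 0)
    (hv : reflLast k x - y ≠ 0) :
    dirac (fun y => weight x y • vecInv (reflLast k x - y)) y =
      vec (weightGrad x y) * vecInv (reflLast k x - y) +
      (k * weight x y) • (vecInv (reflLast k x - y) * vecInv (reflLast k x - y)) := by
  rw [dirac_smul (hasFDerivAt_weight hy hv) (differentiableAt_vecInv_sub hv),
    dirac_vecInv_sub hv, smul_smul, mul_comm (weight x y)]

theorem differentiableAt_weight_vecInv {k : ℕ} {x y : Space k} (hy : y (lastIdx k) ≠ 0)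
    (hv : reflLast k x - y ≠ 0) :
    DifferentiableAt ℝ (fun y => weight x y • vecInv (reflLast k x - y)) y :=
  (hasFDerivAt_weight hy hv).differentiableAt.smul (differentiableAt_vecInv_sub hv)

/-- The gradient in y of ‖x - y‖^(-k) is -k times the Cauchy kernel; it produces the mixed term,
which pairs with the derivative of `weightedE` in the cancellation. -/
theorem dirac_weightedF {k : ℕ} {x y : Space k} (hy : y (lastIdx k) ≠ 0) (hu : x - y ≠ 0)
    (hv : reflLast k x - y ≠ 0) :
    dirac (fun y => weightedF (x, y)) y =
      vec (weightGrad x y) * (newton 0 (x - y) * vecInv (reflLast k x - y)) +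
      (k * weight x y) • (newton 0 (x - y) *
        (vecInv (reflLast k x - y) * vecInv (reflLast k x - y)) -
        cauchy 0 (x - y) * vecInv (reflLast k x - y)) := by
  have h : (fun y => weightedF (x, y)) =
      fun y => invPow k 0 (x - y) • (weight x y • vecInv (reflLast k x - y)) := by
    ext1 y
    simp only [weightedF, newton, smul_mul_assoc, one_mul, smul_smul, mul_comm]
  rw [h, dirac_smul (hasFDerivAt_invPow_sub k hu)
    (differentiableAt_weight_vecInv hy hv), dirac_weight_vecInv hy hv, newton, cauchy,
    ← vecL_apply, map_smul, vecL_apply]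
  simp only [smul_mul_assoc, one_mul, mul_smul_comm, neg_mul, smul_add, smul_sub, smul_smul,
    neg_smul]
  module

/-! ### Linearity of the operators and their action on integrals. -/

theorem diracHodge_eq {k : ℕ} (f : Space k → Cl k) (y : Space k) :
    diracHodge f y = dirac f y + ((k : ℝ) / y (lastIdx k)) • projQL k (f y) := by
  rw [diracHodge, projQL_apply]

theorem dirac_add {k : ℕ} {f g : Space k → Cl k} {y : Space k} (hf : DifferentiableAt ℝ f y)
    (hg : DifferentiableAt ℝ g y) : dirac (fun y => f y + g y) y = dirac f y + dirac g y := by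
  rw [dirac_eq, (hf.hasFDerivAt.fun_add hg.hasFDerivAt).fderiv, ← diracSumL_apply, map_add]
  simp only [diracSumL_apply, dirac_eq]

theorem dirac_sub {k : ℕ} {f g : Space k → Cl k} {y : Space k} (hf : DifferentiableAt ℝ f y)
    (hg : DifferentiableAt ℝ g y) : dirac (fun y => f y - g y) y = dirac f y - dirac g y := by
  rw [dirac_eq, (hf.hasFDerivAt.fun_sub hg.hasFDerivAt).fderiv, ← diracSumL_apply, map_sub]
  simp only [diracSumL_apply, dirac_eq]

theorem dirac_const_smul {k : ℕ} (c : ℝ) {f : Space k → Cl k} {y : Space k}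
    (hf : DifferentiableAt ℝ f y) : dirac (fun y => c • f y) y = c • dirac f y := by
  rw [dirac_eq, (hf.hasFDerivAt.fun_const_smul c).fderiv, ← diracSumL_apply, map_smul]
  simp only [diracSumL_apply, dirac_eq]

theorem diracHodge_add {k : ℕ} {f g : Space k → Cl k} {y : Space k} (hf : DifferentiableAt ℝ f y)
    (hg : DifferentiableAt ℝ g y) :
    diracHodge (fun y => f y + g y) y = diracHodge f y + diracHodge g y := by
  simp only [diracHodge_eq, dirac_add hf hg, map_add, smul_add]
  abel

theorem diracHodge_const_smul {k : ℕ} (c : ℝ) {f : Space k → Cl k} {y : Space k}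
    (hf : DifferentiableAt ℝ f y) : diracHodge (fun y => c • f y) y = c • diracHodge f y := by
  simp only [diracHodge_eq, dirac_const_smul c hf, map_smul, smul_add]
  rw [smul_comm c]

theorem diracHodge_congr {k : ℕ} {f g : Space k → Cl k} {y : Space k} (h : f =ᶠ[𝓝 y] g) :
    diracHodge f y = diracHodge g y := by
  rw [diracHodge, diracHodge, dirac, dirac, h.fderiv_eq, h.eq_of_nhds]

theorem sum_e_mul_integral {k : ℕ} {μ : Measure (Space k)} {F : Space k → Space k → Cl k}
    (hF : ∀ v, Integrable (fun x => F x v) μ) :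
    Integrable (fun x => ∑ j, e j * F x (EuclideanSpace.single j 1)) μ ∧
    ∑ j, e j * ∫ x, F x (EuclideanSpace.single j 1) ∂μ =
      ∫ x, ∑ j, e j * F x (EuclideanSpace.single j 1) ∂μ := by
  have h : ∀ j : Fin (k + 2), Integrable (fun x => e j * F x (EuclideanSpace.single j 1)) μ :=
    fun j => (mulL k (e j)).integrable_comp (hF _)
  refine ⟨integrable_finsetSum _ fun j _ => h j, ?_⟩
  rw [integral_finsetSum _ fun j _ => h j]
  exact Finset.sum_congr rfl fun j _ => ((mulL k (e j)).integral_comp_comm (hF _)).symm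

/-- The sum is the weak Dirac derivative of the kernel tested on a slice of `H`; in the last
integral the kernel is frozen at y₀ and only the density is differentiated. -/
theorem dirac_singular_integral {k : ℕ} {κ : Space k → Cl k} {V : Set (Space k)}
    {H : Space k × Space k → Cl k} {C : Set (Space k)} {y₀ : Space k} (hκ : LocallyIntegrable κ)
    (hV : IsOpen V) (hH : ContDiffOn ℝ 1 H (Set.univ ×ˢ V)) (hC : IsCompact C)
    (hH0 : ∀ x ∉ C, ∀ y ∈ V, H (x, y) = 0) (hy₀ : y₀ ∈ V) :
    Integrable (fun x => dirac (fun y => κ (x - y₀) * H (x, y)) y₀) ∧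
    DifferentiableAt ℝ (fun y => ∫ x, κ (x - y) * H (x, y)) y₀ ∧
    dirac (fun y => ∫ x, κ (x - y) * H (x, y)) y₀ =
      (∑ j, e j * ∫ z, κ z * fderiv ℝ (fun z => H (z + y₀, y₀)) z (EuclideanSpace.single j 1)) +
        ∫ x, dirac (fun y => κ (x - y₀) * H (x, y)) y₀ := by
  obtain ⟨hi, T, hT, hTv⟩ := hasFDerivAt_singular_integral hκ hV hH hC hH0 hy₀
  have hd : ∀ x, dirac (fun y => κ (x - y₀) * H (x, y)) y₀ = ∑ j, e j *
      (κ (x - y₀) * fderiv ℝ (fun y => H (x, y)) y₀ (EuclideanSpace.single j 1)) := by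
    intro x
    have h1 : DifferentiableAt ℝ (fun y => H (x, y)) y₀ :=
      (differentiableAt_of_contDiffOn_prod hV hH (x := x) hy₀).comp y₀
        (hasFDerivAt_prodMk_right x y₀).differentiableAt
    have h2 : HasFDerivAt (fun y => κ (x - y₀) * H (x, y)) _ y₀ :=
      (mulL k (κ (x - y₀))).hasFDerivAt.comp y₀ h1.hasFDerivAt
    rw [dirac, h2.fderiv]
    rfl
  obtain ⟨h3, h4⟩ := sum_e_mul_integral hi
  simp only [hd]
  refine ⟨h3, hT.differentiableAt, ?_⟩
  rw [dirac, hT.fderiv, ← h4, ← Finset.sum_add_distrib]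
  exact Finset.sum_congr rfl fun j _ => by rw [hTv, mul_add]

theorem dirac_regular_integral {k : ℕ} {f : Space k × Space k → Cl k}
    {U : Set (Space k × Space k)} (hU : IsOpen U) (hf : ContDiffOn ℝ 1 f U) {A C : Set (Space k)}
    (hA : MeasurableSet A) (hAC : A ⊆ C) (hC : IsCompact C) {y₀ : Space k}
    (hCU : ∀ x ∈ C, (x, y₀) ∈ U) {l : Space k → Cl k} (hl : IntegrableOn l A) :
    IntegrableOn (fun x => dirac (fun y => f (x, y)) y₀ * l x) A ∧
    DifferentiableAt ℝ (fun y => ∫ x in A, f (x, y) * l x) y₀ ∧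
    dirac (fun y => ∫ x in A, f (x, y) * l x) y₀ =
      ∫ x in A, dirac (fun y => f (x, y)) y₀ * l x := by
  obtain ⟨hi, T, hT, hTv⟩ := hasFDerivAt_regular_integral hU hf hA hAC hC hCU hl
  obtain ⟨h3, h4⟩ := sum_e_mul_integral hi
  have hd : ∀ x, dirac (fun y => f (x, y)) y₀ * l x = ∑ j, e j *
      (fderiv ℝ (fun y => f (x, y)) y₀ (EuclideanSpace.single j 1) * l x) := fun x => by
    simp only [dirac, Finset.sum_mul, mul_assoc]
  simp only [hd]
  refine ⟨h3, hT.differentiableAt, ?_⟩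
  rw [dirac, hT.fderiv, ← h4]
  exact Finset.sum_congr rfl fun j _ => by rw [hTv]

/-! ### Smoothness and integrability of the kernels on the half space. -/

theorem isOpen_upperHalfSpace (k : ℕ) : IsOpen (upperHalfSpace k) :=
  isOpen_lt continuous_const (EuclideanSpace.proj (lastIdx k) : Space k →L[ℝ] ℝ).continuous

theorem reflLast_sub_ne_zero {k : ℕ} {x y : Space k} (hx : x ∈ upperHalfSpace k)
    (hy : y ∈ upperHalfSpace k) : reflLast k x - y ≠ 0 := by
  intro h
  have h1 : (reflLast k x - y) (lastIdx k) = 0 := by rw [h]; rfl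
  have hx' : 0 < x (lastIdx k) := hx
  have hy' : 0 < y (lastIdx k) := hy
  simp [reflLast_apply] at h1
  linarith

theorem sq_add_zero_sq_pos {k : ℕ} {z : Space k} (hz : z ≠ 0) : 0 < ‖z‖ ^ 2 + (0 : ℝ) ^ 2 := by
  have := norm_pos_iff.mpr hz
  positivity

theorem contDiffAt_invPow_comp {k : ℕ} (m : ℕ) {φ : Space k × Space k → Space k}
    (hφ : ContDiff ℝ 1 φ) {p : Space k × Space k} (h : φ p ≠ 0) :
    ContDiffAt ℝ 1 (fun p => invPow m 0 (φ p)) p :=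
  (contDiffAt_invPow m (sq_add_zero_sq_pos h)).comp p hφ.contDiffAt

theorem contDiffAt_vec_comp {k : ℕ} {φ : Space k × Space k → Space k}
    (hφ : ContDiff ℝ 1 φ) {p : Space k × Space k} :
    ContDiffAt ℝ 1 (fun p => vec (φ p)) p :=
  (vecL k).contDiff.contDiffAt.comp p hφ.contDiffAt

theorem contDiff_reflLast_sub (k : ℕ) :
    ContDiff ℝ 1 fun p : Space k × Space k => reflLast k p.1 - p.2 :=
  ((reflL k).contDiff.comp contDiff_fst).sub contDiff_snd

theorem contDiffAt_vecInv_comp {k : ℕ} {φ : Space k × Space k → Space k}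
    (hφ : ContDiff ℝ 1 φ) {p : Space k × Space k} (h : φ p ≠ 0) :
    ContDiffAt ℝ 1 (fun p => vecInv (φ p)) p := by
  simp only [vecInv_eq]
  exact (contDiffAt_invPow_comp 2 hφ h).neg.smul (contDiffAt_vec_comp hφ)

theorem contDiffAt_weight {k : ℕ} {p : Space k × Space k} (h1 : p.1 ∈ upperHalfSpace k)
    (h2 : p.2 ∈ upperHalfSpace k) :
    ContDiffAt ℝ 1 (fun p : Space k × Space k => weight p.1 p.2) p := by
  refine ContDiffAt.mul (𝔸 := ℝ) ?_ (contDiffAt_invPow_comp k (contDiff_reflLast_sub k)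
    (reflLast_sub_ne_zero h1 h2))
  exact ((contDiff_const.mul ((EuclideanSpace.proj (lastIdx k) : Space k →L[ℝ] ℝ).contDiff.comp
    contDiff_snd)).pow k).contDiffAt

theorem contDiffAt_cl_mul {k : ℕ} {E : Type*} [NormedAddCommGroup E] [NormedSpace ℝ E]
    {f g : E → Cl k} {x : E} (hf : ContDiffAt ℝ 1 f x) (hg : ContDiffAt ℝ 1 g x) :
    ContDiffAt ℝ 1 (fun x => f x * g x) x :=
  (mulL k).isBoundedBilinearMap.contDiff.contDiffAt.comp x (hf.prodMk hg)

theorem contDiffAt_weightedE {k : ℕ} {p : Space k × Space k} (h1 : p.1 ∈ upperHalfSpace k)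
    (h2 : p.2 ∈ upperHalfSpace k) (h : p.1 ≠ p.2) : ContDiffAt ℝ 1 weightedE p := by
  have hφ : ContDiff ℝ 1 fun p : Space k × Space k => p.1 - p.2 := contDiff_fst.sub contDiff_snd
  exact (contDiffAt_weight h1 h2).smul
    ((contDiffAt_invPow_comp (k + 2) hφ (sub_ne_zero.mpr h)).neg.smul (contDiffAt_vec_comp hφ))

theorem contDiffAt_weightedF {k : ℕ} {p : Space k × Space k} (h1 : p.1 ∈ upperHalfSpace k)
    (h2 : p.2 ∈ upperHalfSpace k) (h : p.1 ≠ p.2) : ContDiffAt ℝ 1 weightedF p := by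
  have hφ : ContDiff ℝ 1 fun p : Space k × Space k => p.1 - p.2 := contDiff_fst.sub contDiff_snd
  refine (contDiffAt_weight h1 h2).smul (contDiffAt_cl_mul ?_
    (contDiffAt_vecInv_comp (contDiff_reflLast_sub k) (reflLast_sub_ne_zero h1 h2)))
  exact (contDiffAt_invPow_comp k hφ (sub_ne_zero.mpr h)).smul
    (contDiffAt_const (c := (1 : Cl k)))

/-- Isolates a singular kernel of convolution type; the smooth weight is absorbed in the density. -/
theorem weightedE_mul {k : ℕ} (x y : Space k) (a : Cl k) :
    weightedE (x, y) * a = cauchy 0 (x - y) * (weight x y • a) := by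
  rw [weightedE, smul_mul_assoc, mul_smul_comm]

theorem weightedF_mul {k : ℕ} (x y : Space k) (a : Cl k) :
    weightedF (x, y) * a = newton 0 (x - y) * (weight x y • (vecInv (reflLast k x - y) * a)) := by
  rw [weightedF, smul_mul_assoc, mul_smul_comm, mul_assoc]

/-- At x = y the distance to the mirror point is 2 y_n. This is why (2 y_n)^(n-2) is the right
normalization. -/
theorem weight_self {k : ℕ} {y : Space k} (hy : y ∈ upperHalfSpace k) : weight y y = 1 := by
  have h : ‖reflLast k y - y‖ = 2 * y (lastIdx k) := by
    have hy' : 0 < y (lastIdx k) := hy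
    rw [← norm_sub_rev, sub_reflLast_self, norm_smul, PiLp.norm_single, norm_one, mul_one,
      Real.norm_of_nonneg (by positivity)]
  have hy' : 0 < y (lastIdx k) := hy
  rw [weight, invPow_zero, h, mul_inv_cancel₀ (by positivity)]

theorem continuousOn_cl_mul {k : ℕ} {α : Type*} [TopologicalSpace α] {f g : α → Cl k} {s : Set α}
    (hf : ContinuousOn f s) (hg : ContinuousOn g s) : ContinuousOn (fun x => f x * g x) s :=
  (mulL k).continuous₂.comp_continuousOn (hf.prodMk hg)

section Integrability

variable {k : ℕ} {C : Set (Space k)} {y : Space k} {l : Space k → Cl k}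

theorem integrableOn_weightedE_mul (hC : IsCompact C) (hCU : C ⊆ upperHalfSpace k)
    (hy : y ∈ upperHalfSpace k) (hl : ContinuousOn l C) :
    IntegrableOn (fun x => weightedE (x, y) * l x) C := by
  simp only [weightedE_mul]
  refine integrableOn_cl_mul (locallyIntegrable_comp_sub_right locallyIntegrable_cauchy y) hC
    (ContinuousOn.fun_smul ?_ hl)
  intro x hx
  exact ((contDiffAt_weight (p := (x, y)) (hCU hx) hy).continuousAt.comp
    (f := fun x => (x, y)) (by fun_prop)).continuousWithinAt

theorem integrableOn_weightedF_mul (hC : IsCompact C) (hCU : C ⊆ upperHalfSpace k)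
    (hy : y ∈ upperHalfSpace k) (hl : ContinuousOn l C) :
    IntegrableOn (fun x => weightedF (x, y) * l x) C := by
  simp only [weightedF_mul]
  refine integrableOn_cl_mul (locallyIntegrable_comp_sub_right locallyIntegrable_newton y) hC
    (ContinuousOn.fun_smul ?_ ?_)
  · intro x hx
    exact ((contDiffAt_weight (p := (x, y)) (hCU hx) hy).continuousAt.comp
      (f := fun x => (x, y)) (by fun_prop)).continuousWithinAt
  · refine continuousOn_cl_mul ?_ hl
    intro x hx
    exact ((contDiffAt_vecInv_comp (p := (x, y)) (contDiff_reflLast_sub k)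
      (reflLast_sub_ne_zero (hCU hx) hy)).continuousAt.comp
      (f := fun x => (x, y)) (by fun_prop)).continuousWithinAt

end Integrability

/-! ### The Dirac-Hodge operator on potentials, away from and at the singularity. -/

/-- The potential of a density whose support avoids `y` is Dirac-Hodge null at `y`. -/
theorem diracHodge_regular {k : ℕ} {A C : Set (Space k)} (hA : MeasurableSet A) (hAC : A ⊆ C)
    (hC : IsCompact C) (hCU : C ⊆ upperHalfSpace k) {y : Space k} (hy : y ∈ upperHalfSpace k)
    (hyC : y ∉ C) {l : Space k → Cl k} (hl : ContinuousOn l C) :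
    DifferentiableAt ℝ (fun y => (∫ x in A, weightedE (x, y) * l x) -
      ∫ x in A, weightedF (x, y) * hat (l x)) y ∧
    diracHodge (fun y => (∫ x in A, weightedE (x, y) * l x) -
      ∫ x in A, weightedF (x, y) * hat (l x)) y = 0 := by
  set U : Set (Space k × Space k) := (upperHalfSpace k ×ˢ upperHalfSpace k) ∩ {p | p.1 ≠ p.2}
  have hU : IsOpen U := ((isOpen_upperHalfSpace k).prod (isOpen_upperHalfSpace k)).inter
    (isOpen_ne_fun continuous_fst continuous_snd)
  have hCU' : ∀ x ∈ C, (x, y) ∈ U := fun x hx => ⟨⟨hCU hx, hy⟩, fun h => hyC (by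
    have h' : x = y := h
    exact h' ▸ hx)⟩
  have hhl : ContinuousOn (fun x => hat (l x)) C := continuous_hat.comp_continuousOn hl
  have hy0 : y (lastIdx k) ≠ 0 := (show 0 < y (lastIdx k) from hy).ne'
  obtain ⟨i1, d1, e1⟩ := dirac_regular_integral hU
    (fun p hp => (contDiffAt_weightedE hp.1.1 hp.1.2 hp.2).contDiffWithinAt) hA hAC hC hCU'
    ((hl.integrableOn_compact hC).mono_set hAC)
  obtain ⟨i2, d2, e2⟩ := dirac_regular_integral hU
    (fun p hp => (contDiffAt_weightedF hp.1.1 hp.1.2 hp.2).contDiffWithinAt) hA hAC hC hCU'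
    ((hhl.integrableOn_compact hC).mono_set hAC)
  have j1 := (integrableOn_weightedE_mul hC hCU hy hl).mono_set hAC
  have j2 := (integrableOn_weightedF_mul hC hCU hy hhl).mono_set hAC
  refine ⟨d1.sub d2, ?_⟩
  rw [diracHodge_eq, dirac_sub d1 d2, e1, e2, ← integral_sub i1 i2, ← integral_sub j1 j2,
    ← (projQL k).integral_comp_comm (Integrable.sub' j1 j2), ← integral_smul,
    ← integral_add (Integrable.sub' i1 i2) (((projQL k).integrable_comp (Integrable.sub' j1 j2)).fun_smul _)]
  rw [setIntegral_congr_fun hA (g := fun _ => 0), integral_zero]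
  intro x hx
  obtain ⟨⟨hx1, -⟩, hne⟩ := hCU' x (hAC hx)
  have hu : x - y ≠ 0 := sub_ne_zero.mpr hne
  have hv := reflLast_sub_ne_zero hx1 hy
  simp only [projQL_apply]
  rw [← kernelDirac_add_projQ' hy0 hu hv (l x), dirac_weightedE hy0 hu hv,
    dirac_weightedF hy0 hu hv, kernelDirac]
  congr 1
  simp only [mul_sub, add_mul, smul_sub, sub_mul, smul_mul_assoc, mul_assoc]
  abel

/-- The potential of a `C¹` compactly supported density inverts the Dirac-Hodge operator. -/
theorem diracHodge_singular {k : ℕ} {g : Space k → Cl k} (hg : ContDiff ℝ 1 g)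
    (hgc : HasCompactSupport g) (hgU : tsupport g ⊆ upperHalfSpace k) {y : Space k}
    (hy : y ∈ upperHalfSpace k) :
    DifferentiableAt ℝ (fun y => (∫ x, weightedE (x, y) * g x) -
      ∫ x, weightedF (x, y) * hat (g x)) y ∧
    diracHodge (fun y => (∫ x, weightedE (x, y) * g x) -
      ∫ x, weightedF (x, y) * hat (g x)) y = -(sphereArea k • g y) := by
  set H₁ : Space k × Space k → Cl k := fun p => weight p.1 p.2 • g p.1
  set H₂ : Space k × Space k → Cl k := fun p =>
    weight p.1 p.2 • (vecInv (reflLast k p.1 - p.2) * hat (g p.1))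
  have hV := isOpen_upperHalfSpace k
  have hy0 : y (lastIdx k) ≠ 0 := (show 0 < y (lastIdx k) from hy).ne'
  have hg0 : ∀ x ∉ tsupport g, g x = 0 := fun x hx => image_eq_zero_of_notMem_tsupport hx
  have z₁ : ∀ x ∉ tsupport g, ∀ y ∈ upperHalfSpace k, H₁ (x, y) = 0 := fun x hx y _ => by
    simp [H₁, hg0 x hx]
  have z₂ : ∀ x ∉ tsupport g, ∀ y ∈ upperHalfSpace k, H₂ (x, y) = 0 := fun x hx y _ => by
    simp [H₂, hg0 x hx]
  -- The weight and the reflected inverse are controlled only for x in the half space, but the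
  -- density vanishes near every x outside the support of `g`, so the products are C¹ for all x.
  have hsmooth : ∀ (H : Space k × Space k → Cl k),
      (∀ x ∉ tsupport g, ∀ y ∈ upperHalfSpace k, H (x, y) = 0) →
      (∀ p : Space k × Space k, p.1 ∈ upperHalfSpace k → p.2 ∈ upperHalfSpace k →
        ContDiffAt ℝ 1 H p) → ContDiffOn ℝ 1 H (Set.univ ×ˢ upperHalfSpace k) := by
    rintro H hz hH ⟨x, y⟩ ⟨-, hy⟩
    refine ContDiffAt.contDiffWithinAt ?_
    by_cases hx : x ∈ tsupport g
    · exact hH (x, y) (hgU hx) hy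
    · refine (contDiffAt_const (c := (0 : Cl k))).congr_of_eventuallyEq ?_
      filter_upwards [((isClosed_tsupport g).isOpen_compl.prod hV).mem_nhds ⟨hx, hy⟩] with p hp
      exact hz p.1 hp.1 p.2 hp.2
  have s₁ : ContDiffOn ℝ 1 H₁ (Set.univ ×ˢ upperHalfSpace k) := hsmooth H₁ z₁ fun p h1 h2 =>
    (contDiffAt_weight h1 h2).smul (hg.contDiffAt.comp p contDiffAt_fst)
  have s₂ : ContDiffOn ℝ 1 H₂ (Set.univ ×ˢ upperHalfSpace k) := hsmooth H₂ z₂ fun p h1 h2 =>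
    (contDiffAt_weight h1 h2).smul (contDiffAt_cl_mul
      (contDiffAt_vecInv_comp (contDiff_reflLast_sub k) (reflLast_sub_ne_zero h1 h2))
      ((hatL k).contDiff.contDiffAt.comp p (hg.contDiffAt.comp p contDiffAt_fst)))
  obtain ⟨i1, d1, e1⟩ := dirac_singular_integral locallyIntegrable_cauchy hV s₁ hgc z₁ hy
  obtain ⟨i2, d2, e2⟩ := dirac_singular_integral locallyIntegrable_newton hV s₂ hgc z₂ hy
  -- The point mass yields -ω_n H₁(y, y); the `newton` part yields no point mass, only -k times the
  -- Cauchy kernel integrated against `H₂`.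
  rw [sum_e_mul_integral_cauchy (contDiff_translate s₁ hy)
    (hasCompactSupport_translate hgc z₁ hy)] at e1
  rw [sum_e_mul_integral_newton (contDiff_translate s₂ hy)
    (hasCompactSupport_translate hgc z₂ hy)] at e2
  have t : (∫ z, cauchy 0 z * H₂ (z + y, y)) = ∫ x, cauchy 0 (x - y) * H₂ (x, y) := by
    rw [← integral_add_right_eq_self (fun x => cauchy 0 (x - y) * H₂ (x, y)) y]
    simp
  have hslice : ∀ {κ : Space k → Cl k} {H : Space k × Space k → Cl k}, LocallyIntegrable κ →
      ContDiffOn ℝ 1 H (Set.univ ×ˢ upperHalfSpace k) →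
      (∀ x ∉ tsupport g, ∀ y ∈ upperHalfSpace k, H (x, y) = 0) →
      Integrable fun x => κ (x - y) * H (x, y) := fun hκ hH hz =>
    integrable_cl_mul (locallyIntegrable_comp_sub_right hκ y) (by
      rw [← continuousOn_univ]
      exact hH.continuousOn.comp (by fun_prop) fun x _ => ⟨trivial, hy⟩)
      (HasCompactSupport.intro hgc fun x hx => hz x hx y hy)
  have j1 := hslice locallyIntegrable_cauchy s₁ z₁
  have j2 := hslice locallyIntegrable_newton s₂ z₂
  have j3 := hslice locallyIntegrable_cauchy s₂ z₂
  rw [t] at e2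
  simp only [weightedE_mul, weightedF_mul]
  refine ⟨d1.sub d2, ?_⟩
  rw [diracHodge_eq, dirac_sub d1 d2, e1, e2, ← integral_sub j1 j2,
    ← (projQL k).integral_comp_comm (Integrable.sub' j1 j2), ← integral_smul, ← integral_smul]
  -- Everything except the point mass. The third integral, left by the integration by parts, plays
  -- the role of the derivative of ‖x - y‖^(-k), so the combined integrand is the expression
  -- annihilated in `kernelDirac_add_projQ'`.
  have hsum : (∫ x, dirac (fun y' => cauchy 0 (x - y) * H₁ (x, y')) y) -
      (∫ x, dirac (fun y' => newton 0 (x - y) * H₂ (x, y')) y) +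
      (∫ x, (k : ℝ) • (cauchy 0 (x - y) * H₂ (x, y))) +
      (∫ x, ((k : ℝ) / y (lastIdx k)) •
        projQL k (cauchy 0 (x - y) * H₁ (x, y) - newton 0 (x - y) * H₂ (x, y))) = 0 := by
    rw [← integral_sub i1 i2, ← integral_add (Integrable.sub' i1 i2) (j3.fun_smul _),
      ← integral_add (Integrable.fun_add (Integrable.sub' i1 i2) (j3.fun_smul _))
        (((projQL k).integrable_comp (Integrable.sub' j1 j2)).fun_smul _)]
    refine integral_eq_zero_of_ae ?_
    filter_upwards [compl_mem_ae_iff.mpr (measure_singleton (μ := (volume : Measure (Space k))) y)]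
      with x hxy
    have hu : x - y ≠ 0 := sub_ne_zero.mpr hxy
    by_cases hx : x ∈ tsupport g
    · have hv := reflLast_sub_ne_zero (hgU hx) hy
      have f1 : dirac (fun y' => cauchy 0 (x - y) * H₁ (x, y')) y =
          vec (weightGrad x y) * (cauchy 0 (x - y) * g x) := by
        simp only [H₁, mul_smul_comm]
        rw [dirac_smul (hasFDerivAt_weight hy0 hv) (differentiableAt_const _), dirac_const,
          smul_zero, add_zero]
      have f2 : dirac (fun y' => newton 0 (x - y) * H₂ (x, y')) y =
          (vec (weightGrad x y) * vecInv (reflLast k x - y) + (k * weight x y) •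
            (vecInv (reflLast k x - y) * vecInv (reflLast k x - y))) *
          (invPow k 0 (x - y) • hat (g x)) := by
        have : ∀ y', newton 0 (x - y) * H₂ (x, y') =
            (weight x y' • vecInv (reflLast k x - y')) * (invPow k 0 (x - y) • hat (g x)) := by
          intro y'
          simp only [H₂, newton, smul_mul_assoc, mul_smul_comm, one_mul, smul_smul, mul_comm]
        simp only [this]
        rw [dirac_mul_const (differentiableAt_weight_vecInv hy0 hv),
          dirac_weight_vecInv hy0 hv]
      have f3 := kernelDirac_add_projQ' hy0 hu hv (g x)
      rw [weightedE_mul, weightedF_mul] at f3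
      simp only [Pi.zero_apply, f1, f2, projQL_apply]
      rw [← f3]
      congr 1
      simp only [kernelDirac, H₂, newton, mul_sub, add_mul, smul_sub, smul_mul_assoc,
        mul_smul_comm, mul_assoc, one_mul, smul_add, smul_smul]
      module
    · have f1 : ∀ y', H₁ (x, y') = 0 := fun y' => by simp [H₁, hg0 x hx]
      have f2 : ∀ y', H₂ (x, y') = 0 := fun y' => by simp [H₂, hg0 x hx]
      simp [f1, f2, dirac_const, projQ'_eq]
  have h0 : H₁ (0 + y, y) = g y := by
    simp [H₁, weight_self hy]
  rw [h0]
  rw [← sub_eq_zero]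
  refine Eq.trans ?_ hsum
  abel

/-! ### Cutting off the density and assembling the result. -/

theorem IsC1OnClosure.contDiffOn {k : ℕ} {K : Set (Space k)} {L : Space k → Cl k} (hK : IsOpen K)
    (hL : IsC1OnClosure K L) : ContDiffOn ℝ 1 L K := by
  obtain ⟨-, L', hL', hd⟩ := hL
  rw [show (1 : WithTop ℕ∞) = 0 + 1 by simp, contDiffOn_succ_iff_fderiv_of_isOpen hK]
  refine ⟨fun x hx => (hd x hx).differentiableAt.differentiableWithinAt, by simp, ?_⟩
  rw [contDiffOn_zero]
  exact (hL'.mono subset_closure).congr fun x hx => (hd x hx).fderiv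

theorem contDiff_smul_of_tsupport_subset {k : ℕ} {K : Set (Space k)} {L : Space k → Cl k}
    {χ : Space k → ℝ} (hK : IsOpen K) (hL : ContDiffOn ℝ 1 L K) (hχ : ContDiff ℝ 1 χ)
    (hs : tsupport χ ⊆ K) : ContDiff ℝ 1 fun x => χ x • L x := by
  refine contDiff_iff_contDiffAt.mpr fun x => ?_
  by_cases hx : x ∈ tsupport χ
  · exact hχ.contDiffAt.smul (hL.contDiffAt (hK.mem_nhds (hs hx)))
  · refine (contDiffAt_const (c := (0 : Cl k))).congr_of_eventuallyEq ?_
    filter_upwards [(isClosed_tsupport χ).isOpen_compl.mem_nhds hx] with z hz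
    rw [image_eq_zero_of_notMem_tsupport hz, zero_smul]

theorem potential_eq {k : ℕ} (K : Set (Space k)) (L : Space k → Cl k) (y : Space k) :
    potential K L y = (-(sphereArea k)⁻¹) • ((∫ x in K, weightedE (x, y) * L x) -
      ∫ x in K, weightedF (x, y) * hat (L x)) := by
  simp only [weightedE_eq, weightedF_eq, smul_mul_assoc, integral_smul]
  rw [potential, ← smul_sub, smul_smul]
  congr 1
  rw [mul_pow]
  ring

/-- Puts each piece in the domain its differentiation lemma expects: the compactly supported one on
the whole space, the other on the set `A` away from the singularity. -/
theorem setIntegral_mul_split {k : ℕ} {K A : Set (Space k)} {W g l L : Space k → Cl k}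
    (hAK : A ⊆ K) (hK : MeasurableSet K) (hL : ∀ x, L x = g x + l x) (hg : ∀ x ∉ K, g x = 0)
    (hl : ∀ x ∈ K \ A, l x = 0) (ig : IntegrableOn (fun x => W x * g x) K)
    (il : IntegrableOn (fun x => W x * l x) K) :
    ∫ x in K, W x * L x = (∫ x, W x * g x) + ∫ x in A, W x * l x := by
  simp only [hL, mul_add]
  rw [integral_add ig il, setIntegral_eq_integral_of_forall_compl_eq_zero,
    setIntegral_eq_of_subset_of_forall_sdiff_eq_zero hK hAK]
  · intro x hx
    rw [hl x hx, mul_zero]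
  · intro x hx
    rw [hg x hx, mul_zero]

end

end DiracHodge

theorem theorem14 (k : ℕ) (hk : 1 ≤ k) (K : Set (Space k)) (hKo : IsOpen K)
    (hKb : Bornology.IsBounded K) (hKH : closure K ⊆ upperHalfSpace k)
    (L : Space k → Cl k) (hL : IsC1OnClosure K L) (y : Space k) (hy : y ∈ K) :
    IntegrableOn (fun x => kernelE x y * L x) K ∧
    IntegrableOn (fun x => kernelF x y * hat (L x)) K ∧
    DifferentiableAt ℝ (potential K L) y ∧
    diracHodge (potential K L) y = L y := by
  have hC : IsCompact (closure K) := hKb.isCompact_closure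
  have hKU : K ⊆ upperHalfSpace k := subset_closure.trans hKH
  have hLc : ContinuousOn L (closure K) := hL.1
  have hpos : 0 < (2 * y (lastIdx k)) ^ k := by
    have : 0 < y (lastIdx k) := hKU hy
    positivity
  -- The estimates concern the weighted kernels; dividing by the nonzero scalar (2 y_n)^k returns to
  -- E and F.
  have hcancel : ∀ A B : Cl k, ((2 * y (lastIdx k)) ^ k)⁻¹ • (((2 * y (lastIdx k)) ^ k • A) * B) =
      A * B := fun A B => by
    rw [smul_mul_assoc, smul_smul, inv_mul_cancel₀ hpos.ne', one_smul]
  obtain ⟨ε, hε, hεK⟩ := Metric.nhds_basis_closedBall.mem_iff.mp (hKo.mem_nhds hy)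
  -- The outer radius keeps the support inside `K`; the inner one makes `l` vanish on the ball of
  -- radius ε/2 about y.
  let χ : ContDiffBump y := ⟨ε / 2, ε, by positivity, by linarith⟩
  have hχs : tsupport χ ⊆ K := by rw [χ.tsupport_eq]; exact hεK
  set g : Space k → Cl k := fun x => χ x • L x with hgdef
  set l : Space k → Cl k := fun x => (1 - χ x) • L x with hldef
  have hg : ContDiff ℝ 1 g :=
    contDiff_smul_of_tsupport_subset hKo (hL.contDiffOn hKo) χ.contDiff hχs
  have hgs : tsupport g ⊆ tsupport χ := closure_mono fun x hx h0 => hx (by simp [hgdef, h0])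
  have hgc : HasCompactSupport g := χ.hasCompactSupport.smul_right
  have hlc : ContinuousOn l (closure K) :=
    (continuous_const.sub χ.continuous).continuousOn.smul hLc
  have hsplit : ∀ x, L x = g x + l x := fun x => by
    simp only [hgdef, hldef]; module
  have hg0 : ∀ x ∉ K, g x = 0 := fun x hx =>
    image_eq_zero_of_notMem_tsupport fun h => hx (hχs (hgs h))
  set A := K \ Metric.ball y (ε / 2)
  have hl0 : ∀ x ∈ K \ A, l x = 0 := by
    rintro x ⟨hxK, hxA⟩
    have hx : x ∈ Metric.ball y (ε / 2) := by
      by_contra h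
      exact hxA ⟨hxK, h⟩
    have h1 : χ x = 1 := χ.one_of_mem_closedBall (Metric.ball_subset_closedBall hx)
    simp [hldef, h1]
  obtain ⟨d1, m1⟩ := diracHodge_singular hg hgc (hgs.trans (hχs.trans hKU)) (hKU hy)
  -- Removing the open ball leaves a compact set that misses y, although `l` need not have compact
  -- support in `K`.
  obtain ⟨d2, m2⟩ := diracHodge_regular (A := A) (C := closure K \ Metric.ball y (ε / 2))
    (hKo.measurableSet.diff measurableSet_ball) (Set.sdiff_subset_sdiff_left subset_closure)
    (hC.diff Metric.isOpen_ball) (Set.sdiff_subset.trans hKH) (hKU hy)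
    (fun h => h.2 (Metric.mem_ball_self (by positivity))) (hlc.mono Set.sdiff_subset)
  have hpot : potential K L =ᶠ[nhds y] fun y => (-(sphereArea k)⁻¹) •
      (((∫ x, weightedE (x, y) * g x) - ∫ x, weightedF (x, y) * hat (g x)) +
        ((∫ x in A, weightedE (x, y) * l x) - ∫ x in A, weightedF (x, y) * hat (l x))) := by
    -- The evaluation point now varies in `K` while χ, g, l and A stay attached to the original
    -- point; equality on a neighbourhood is what differentiation requires.
    filter_upwards [hKo.mem_nhds hy] with y hy
    rw [potential_eq, setIntegral_mul_split (A := A) Set.sdiff_subset hKo.measurableSet hsplit hg0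
      hl0 ((integrableOn_weightedE_mul hC hKH (hKU hy) hg.continuous.continuousOn).mono_set
        subset_closure) ((integrableOn_weightedE_mul hC hKH (hKU hy) hlc).mono_set subset_closure),
      setIntegral_mul_split (A := A) (g := fun x => hat (g x)) (l := fun x => hat (l x))
        Set.sdiff_subset hKo.measurableSet (fun x => by rw [hsplit, map_add])
        (fun x hx => by rw [hg0 x hx, map_zero]) (fun x hx => by rw [hl0 x hx, map_zero])
        ((integrableOn_weightedF_mul hC hKH (hKU hy)
          (continuous_hat.comp hg.continuous).continuousOn).mono_set subset_closure)
        ((integrableOn_weightedF_mul hC hKH (hKU hy)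
          (continuous_hat.comp_continuousOn hlc)).mono_set subset_closure)]
    congr 1
    abel
  refine ⟨?_, ?_, ?_, ?_⟩
  · have h := (integrableOn_weightedE_mul hC hKH (hKU hy) hLc).mono_set subset_closure
    rw [IntegrableOn]
    simpa only [weightedE_eq, hcancel] using Integrable.fun_smul ((2 * y (lastIdx k)) ^ k)⁻¹ h
  · have h := (integrableOn_weightedF_mul hC hKH (hKU hy)
      (continuous_hat.comp_continuousOn hLc)).mono_set subset_closure
    rw [IntegrableOn]
    simpa only [weightedF_eq, Function.comp_apply, hcancel] using
      Integrable.fun_smul ((2 * y (lastIdx k)) ^ k)⁻¹ h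
  · exact ((d1.fun_add d2).fun_const_smul _).congr_of_eventuallyEq hpot
  · have hgy : g y = L y := by
      have h1 : χ y = 1 := χ.one_of_mem_closedBall (Metric.mem_closedBall_self (by positivity))
      simp [hgdef, h1]
    rw [diracHodge_congr hpot, diracHodge_const_smul _ (d1.fun_add d2), diracHodge_add d1 d2, m1, m2,
      add_zero, smul_neg, neg_smul, neg_neg, smul_smul, inv_mul_cancel₀ (sphereArea_pos k).ne',
      one_smul, hgy]
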